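/- Let $u\ge 0$ be an integer, let $k\ge 2$ be an even integer, and let $a_1,\dots,a_u$ and $c_1,\dots,c_k$ be positive integers. Write $q=e^{2\pi i\tau}$ with $\tau$ in the upper half plane $\mathbb H$, and put $$\mathcal F(\tau)=\sum_{m,n\in\mathbb Z}q^{m^2+mn+n^2},\qquad \Psi(\tau)=\sum_{n\ge 0}q^{n(n+1)/2},\qquad \psi_{l,t}(\tau)=\prod_{i=1}^{u}\mathcal F(a_i\tau)\prod_{j=1}^{k}\Psi(c_j\tau).$$ Then $\psi_{l,t}$ is the generating function of the mixed form $\sum_{i=1}^u a_i(x_{2i-1}^2+x_{2i-1}x_{2i}+x_{2i}^2)+\sum_{j=1}^k c_j\frac{z_j(z_j+1)}2$ with $x\in\mathbb Z^{2u}$, $z\in\mathbb Z_{\ge0}^k$; that is, $\psi_{l,t}(\tau)=\sum_{n\ge0}N(n)q^n$ for all $\tau\in\mathbb H$, where $N(n)$ is the number of representations of $n$ by this form. Put $\mathbf h=c_1+\dots+c_k$ and $\mathbf c=c_1\cdots c_k$, let $$L=\operatorname{lcm}\bigl(3\operatorname{lcm}(a_1,\dots,a_u),\,2\operatorname{lcm}(c_1,\dots,c_k)\bigr)$$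 (the lcm of the empty family is $1$), let $\chi=\left(\frac{(-1)^{k/2}4\mathbf c}{\cdot}\right)$ (Kronecker symbol), and let $\chi'=\chi$ if $u$ is even and $\chi'=\left(\frac{\cdot}{3}\right)\chi$ if $u$ is odd. If $\mathbf h$ is a multiple of $8$, then the restriction of $\chi'$ to the integers prime to $L$ defines a Dirichlet character modulo $L$, and $$q^{\mathbf h/8}\,\psi_{l,t}(\tau)\in M_{u+k/2}(\Gamma_0(L),\chi').$$ Here $M_w(\Gamma_0(L),\chi')$ is the space of functions $f$ on $\mathbb H$, holomorphic on $\mathbb H$ and at all cusps, with $f\left(\frac{\alpha\tau+\beta}{\gamma\tau+\delta}\right)=\chi'(\delta)(\gamma\tau+\delta)^w f(\tau)$ for all $\begin{pmatrix}\alpha&\beta\\ \gamma&\delta\end{pmatrix}\in\Gamma_0(L)$. -/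

import Mathlib

open scoped UpperHalfPlane ModularForm

noncomputable section

namespace MixedForms

/-- The nome `q = e^{2 π i τ}`. -/
def nome (τ : ℂ) : ℂ :=
  Complex.exp (2 * Real.pi * Complex.I * τ)

/-- `𝓕(τ) = ∑_{m, n ∈ ℤ} q^{m² + m n + n²}`. -/
def hexTheta (τ : ℂ) : ℂ :=
  ∑' p : ℤ × ℤ, nome τ ^ (p.1 ^ 2 + p.1 * p.2 + p.2 ^ 2)

/-- `Ψ(τ) = ∑_{n ≥ 0} q^{n (n + 1) / 2}` (the division of natural numbers is exact here). -/
def triTheta (τ : ℂ) : ℂ :=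
  ∑' n : ℕ, nome τ ^ (n * (n + 1) / 2)

/-- `ψ(τ) = ∏ 𝓕(a_i τ) ∏ Ψ(c_j τ)`. -/
def mixedTheta {u k : ℕ} (a : Fin u → ℕ) (c : Fin k → ℕ) (τ : ℂ) : ℂ :=
  (∏ i, hexTheta (a i * τ)) * ∏ j, triTheta (c j * τ)

/-- The value of the mixed form
`∑ a_i (x_i² + x_i y_i + y_i²) + ∑ c_j z_j (z_j + 1) / 2`
at pairs of integers `(x_i, y_i)` and natural numbers `z_j`. -/
def mixedForm {u k : ℕ} (a : Fin u → ℕ) (c : Fin k → ℕ)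
    (x : Fin u → ℤ × ℤ) (z : Fin k → ℕ) : ℤ :=
  (∑ i, (a i : ℤ) * ((x i).1 ^ 2 + (x i).1 * (x i).2 + (x i).2 ^ 2)) +
    ∑ j, (c j : ℤ) * ((z j * (z j + 1) / 2 : ℕ) : ℤ)

/-- The number of representations of `n` by the mixed form. -/
def mixedRepr {u k : ℕ} (a : Fin u → ℕ) (c : Fin k → ℕ) (n : ℕ) : ℕ :=
  {p : (Fin u → ℤ × ℤ) × (Fin k → ℕ) | mixedForm a c p.1 p.2 = n}.ncard

/-- The Kronecker symbol `(a / b)` for all integers `a`, `b`: completely multiplicative in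
`b ≠ 0`, equal to the Legendre symbol at odd primes, with `(a / 2) = 0, 1, -1` for `a` even,
`a ≡ ±1`, `a ≡ ±3` modulo `8`, `(a / -1) = -1` exactly when `a < 0`, and
`(a / 0) = 1` for `a = ±1`, `(a / 0) = 0` otherwise. -/
def kroneckerSym (a b : ℤ) : ℤ :=
  if b = 0 then (if a.natAbs = 1 then 1 else 0)
  else
    (if a < 0 ∧ b < 0 then -1 else 1) *
      ZMod.χ₈ (a : ZMod 8) ^ (padicValNat 2 b.natAbs) *
      jacobiSym a (b.natAbs / 2 ^ (padicValNat 2 b.natAbs))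

/-- The level `L = lcm(3 lcm(a_1, …, a_u), 2 lcm(c_1, …, c_k))`; the lcm of the empty family
is `1`. -/
def mixedLevel {u k : ℕ} (a : Fin u → ℕ) (c : Fin k → ℕ) : ℕ :=
  Nat.lcm (3 * Finset.univ.lcm a) (2 * Finset.univ.lcm c)

/-- The value at `d` of the character `χ = ((-1)^{k/2} 4 c_1 ⋯ c_k / ·)`. -/
def triSymbol {k : ℕ} (c : Fin k → ℕ) (d : ℤ) : ℤ :=
  kroneckerSym ((-1) ^ (k / 2) * 4 * ∏ j, (c j : ℤ)) d

/-- The value at `d` of `χ' = χ` (`u` even) or `χ' = (· / 3) χ` (`u` odd). -/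
def mixedSymbol (u : ℕ) {k : ℕ} (c : Fin k → ℕ) (d : ℤ) : ℤ :=
  if Even u then triSymbol c d else legendreSym 3 d * triSymbol c d

/-- The space `M_k(Γ₀(N), χ)`: the modular forms `f` of weight `k` on `Γ₁(N)` (holomorphic on the
upper half plane and at all cusps) with `f((aτ + b)/(cτ + d)) = χ(d) (cτ + d)^k f(τ)` for every
matrix `(a, b; c, d)` in `Γ₀(N)`. -/
def formsWithCharacter (k : ℤ) (N : ℕ) (χ : DirichletCharacter ℂ N) :
    Submodule ℂ (ModularForm
      ((CongruenceSubgroup.Gamma1 N).map (Matrix.SpecialLinearGroup.mapGL ℝ)) k) where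
  carrier := {f | ∀ γ ∈ CongruenceSubgroup.Gamma0 N, ∀ τ : ℍ,
    f (γ • τ) = χ ((γ 1 1 : ℤ) : ZMod N) *
      (((γ 1 0 : ℤ) : ℂ) * (τ : ℂ) + ((γ 1 1 : ℤ) : ℂ)) ^ k * f τ}
  zero_mem' := by
    intro γ _ τ
    simp
  add_mem' := by
    intro f g hf hg γ hγ τ
    simp only [add_apply, hf γ hγ τ, hg γ hγ τ]
    ring
  smul_mem' := by
    intro r f hf γ hγ τ
    simp only [smul_apply, smul_eq_mul, hf γ hγ τ]
    ring

end MixedForms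

end

open MixedForms

/-!
The idea is to reduce both kinds of factors to theta series of rank one and two whose behaviour
under a congruence subgroup can be computed directly.

Since `q^{1/8} Ψ(τ) = θ(τ) / 2` for the theta constant `θ(τ) = ∑_{n ∈ ℤ} exp(π i τ (n + 1/2)²)`,
the function `q^{h/8} ψ` is, up to the factor `2^{-k}`, the product of the `𝓕(a_i τ)` and the
`θ(c_j τ)`. For a matrix `γ = (α, β; γ₀, δ)` with `γ₀` even and `δ > 0` odd, write
`γτ = β/δ + τ/(δ(γ₀τ + δ))`, split the series of `θ` into residue classes modulo `δ` and apply
Poisson summation; a quadratic Gauss sum modulo `δ` times the square root of `(γ₀τ + δ)/δ` comes out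
(`thetaTwo_moebius`). In the product over `j` the square roots agree, so an even number of
factors gives an integral power (`thetaProd_transformsWith`).

Only the squares of the Gauss sums matter, and only at prime `δ`, where they are evaluated by
`gaussSum_sq` (`prod_thetaGauss_prime`); the eighth roots of unity cancel because `8` divides the
sum of the `c_j`. The case of general `δ` follows by moving the lower row of `γ`: right
multiplication by lower unipotent matrices makes the lower left entry divisible by a
large modulus, and then a translation replaces `δ` by a prime in the same residue class, by
Dirichlet's theorem. The Jacobi symbol is unchanged by quadratic reciprocity
(`thetaProd_of_pos`).

For `𝓕`, Poisson summation in both variables gives the Fricke relation between `𝓕(-1/(3τ))` and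
`𝓕(τ)`, hence invariance under `(1, 0; 3n, 1)`. A Euclidean descent on the lower row shows that these
matrices, the translations and `-1` generate `Γ₀(3)` (`hexTheta_transforms`).

That `χ'` is periodic modulo `L` needs no analysis of conductors: comparing the transformation
laws of `γ` and of `γT^n` at a point where the function does not vanish forces it
(`mixedSymbol_add_mul`). Holomorphy at the cusps follows from the bound `‖f‖ ≤ (1 + 1/y)^K`: a
translate of `f` to another cusp is periodic and of polynomial growth in `y`, so that its singularity
in the variable `exp(2π i τ / N)` is removable (`isBoundedAtImInfty_slash`).
-/

open MixedForms

noncomputable section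

namespace MixedForms

open Complex
open scoped MatrixGroups

/-! ### Theta constants and the theta transformation with Gauss sums -/

/-- The theta constant `∑_{n ∈ ℤ} exp(π i τ (n + 1/2)²)`, as a function on `ℂ`; the series converges
exactly for `0 < Im τ`. -/
def thetaTwo (τ : ℂ) : ℂ := ∑' n : ℤ, cexp (Real.pi * I * τ * (n + 1 / 2) ^ 2)

lemma exp_shifted_square_eq (x t : ℂ) (n : ℤ) :
    cexp (Real.pi * I * t * (n + x) ^ 2) =
      cexp (Real.pi * I * t * x ^ 2) * jacobiTheta₂_term n (x * t) t := by
  rw [jacobiTheta₂_term, ← Complex.exp_add]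
  congr 1
  ring

lemma summable_exp_shifted_square (x : ℂ) {t : ℂ} (ht : 0 < t.im) :
    Summable fun n : ℤ => cexp (Real.pi * I * t * (n + x) ^ 2) := by
  simp_rw [exp_shifted_square_eq]
  exact ((summable_jacobiTheta₂_term_iff _ _).2 ht).mul_left _

lemma tsum_exp_shifted_square (x t : ℂ) :
    ∑' n : ℤ, cexp (Real.pi * I * t * (n + x) ^ 2) =
      cexp (Real.pi * I * t * x ^ 2) * jacobiTheta₂ (x * t) t := by
  simp_rw [exp_shifted_square_eq]
  rw [tsum_mul_left, jacobiTheta₂]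

/-- Poisson summation for the shifted Gaussian, from the functional equation of `jacobiTheta₂`. -/
lemma tsum_exp_shifted_square_poisson (x : ℂ) {t : ℂ} (ht : 0 < t.im) :
    ∑' n : ℤ, cexp (Real.pi * I * t * (n + x) ^ 2) =
      1 / (-I * t) ^ (1 / 2 : ℂ) * jacobiTheta₂ x (-1 / t) := by
  have ht0 : t ≠ 0 := by rintro rfl; simp at ht
  rw [tsum_exp_shifted_square, jacobiTheta₂_functional_equation, mul_div_cancel_right₀ _ ht0]
  have : -Real.pi * I * (x * t) ^ 2 / t = -(Real.pi * I * t * x ^ 2) := by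
    field_simp
  rw [this, Complex.exp_neg]
  field_simp [Complex.exp_ne_zero]

lemma thetaTwo_eq (τ : ℂ) :
    thetaTwo τ = cexp (Real.pi * I * τ / 4) * jacobiTheta₂ (τ / 2) τ := by
  rw [thetaTwo, tsum_exp_shifted_square]
  congr 2 <;> ring

lemma jacobiTheta₂_half_neg_inv {τ : ℂ} (hτ : 0 < τ.im) :
    jacobiTheta₂ (1 / 2) (-1 / τ) = (-I * τ) ^ (1 / 2 : ℂ) * thetaTwo τ := by
  have h0 : (-I * τ) ^ (1 / 2 : ℂ) ≠ 0 := by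
    rw [Complex.cpow_ne_zero_iff]
    left
    rintro h
    simp only [mul_eq_zero, neg_eq_zero, I_ne_zero, false_or] at h
    simp [h] at hτ
  rw [thetaTwo, tsum_exp_shifted_square_poisson _ hτ, ← mul_assoc, mul_one_div_cancel h0, one_mul]

lemma tsum_int_eq_sum_residues {f : ℤ → ℂ} (hf : Summable f) (d : ℕ) (hd : 0 < d) :
    ∑' n, f n = ∑ r ∈ Finset.range d, ∑' m : ℤ, f (m * d + r) := by
  have : NeZero d := ⟨hd.ne'⟩
  rw [← (Int.divModEquiv d).symm.tsum_eq f]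
  have hs : Summable fun p : ℤ × Fin d => f ((Int.divModEquiv d).symm p) :=
    (Int.divModEquiv d).symm.summable_iff.2 hf
  rw [← (Equiv.prodComm (Fin d) ℤ).tsum_eq, Summable.tsum_prod, tsum_fintype, Finset.sum_range]
  · rfl
  · exact (Equiv.prodComm (Fin d) ℤ).summable_iff.2 hs

lemma sum_range_shift_of_periodic {d : ℕ} {g : ℤ → ℂ} (hg : ∀ n, g (n + d) = g n) (s : ℤ) :
    ∑ r ∈ Finset.range d, g (r + s) = ∑ r ∈ Finset.range d, g r := by
  have step (s : ℤ) : ∑ r ∈ Finset.range d, g (r + (s + 1)) = ∑ r ∈ Finset.range d, g (r + s) := by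
    have h := Finset.sum_range_succ (fun r : ℕ => g (r + s)) d
    rw [Finset.sum_range_succ' (fun r : ℕ => g (r + s)) d, add_comm (d : ℤ) s, hg] at h
    simp only [Nat.cast_add, Nat.cast_one, Nat.cast_zero, zero_add] at h
    rw [← add_right_cancel h]
    exact Finset.sum_congr rfl fun r _ => by ring_nf
  induction s with
  | zero => simp
  | succ n ih => rw [step, ih]
  | pred n ih => rw [← ih, ← step, sub_add_cancel]

/-- The phase `exp(π i b (2r + 1)² / (4d))` that `r + 1/2` picks up in `thetaTwo` when the argument is
shifted by `b/d`. For odd `d` it depends only on `r` modulo `d`. -/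
def thetaPhase (b : ℤ) (d : ℕ) (r : ℤ) : ℂ :=
  cexp (Real.pi * I * b * (2 * r + 1) ^ 2 / (4 * d))

/-- The quadratic Gauss sum `∑_{r mod d} exp(π i b (2r + 1)² / (4d))`, meaningful for odd `d`. -/
def thetaGauss (b : ℤ) (d : ℕ) : ℂ := ∑ r ∈ Finset.range d, thetaPhase b d r

lemma exp_eq_of_sub_eq {x y : ℂ} (n : ℤ) (h : x - y = n * (2 * Real.pi * I)) :
    cexp x = cexp y :=
  Complex.exp_eq_exp_iff_exists_int.2 ⟨n, by rw [← h]; ring⟩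

lemma thetaPhase_add {d : ℕ} (hd : Odd d) (b r : ℤ) :
    thetaPhase b d (r + d) = thetaPhase b d r := by
  obtain ⟨e, rfl⟩ := hd
  have h0 : (2 * e + 1 : ℂ) ≠ 0 := by exact_mod_cast Nat.succ_ne_zero (2 * e)
  refine exp_eq_of_sub_eq (b * (r + 1 + e)) ?_
  push_cast
  field_simp
  ring

/-- Completing the square: with `b c ≡ -1` modulo `d`, the linear term in the exponent is absorbed by the
shift `r ↦ r - c m`, and only the sign `(-1)^m` is left. -/
lemma sum_thetaPhase_mul {a b c : ℤ} {d : ℕ} (hd : Odd d) (hc : Even c) (h : a * d - b * c = 1)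
    (m : ℤ) :
    ∑ r ∈ Finset.range d, thetaPhase b d r *
      cexp (2 * Real.pi * I * m * ((r + 1 / 2) / d) - Real.pi * I * m ^ 2 * c / d) =
    thetaGauss b d * cexp (Real.pi * I * m) := by
  have h0 : (d : ℂ) ≠ 0 := by exact_mod_cast hd.pos.ne'
  have ha : Odd a := by
    have h1 : Odd (a * d) := by
      rw [sub_eq_iff_eq_add.1 h]
      exact odd_one.add_even (hc.mul_left b)
    exact (Int.odd_mul.1 h1).1
  have h' : (1 + b * c : ℂ) = a * d := by
    have : (a * d - b * c : ℂ) = 1 := by exact_mod_cast h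
    rw [← this]; ring
  rw [thetaGauss, ← sum_range_shift_of_periodic (thetaPhase_add hd b) (-c * m), Finset.sum_mul]
  refine Finset.sum_congr rfl fun r _ => ?_
  obtain ⟨a', rfl⟩ := ha
  obtain ⟨c', rfl⟩ := hc
  rw [thetaPhase, thetaPhase, ← Complex.exp_add, ← Complex.exp_add]
  refine exp_eq_of_sub_eq
    -- The two exponents differ by `π i (m (N a - 1) - m² c a)` with `N = 2r + 1`, where `N` and `a`
    -- are odd and `c` is even.
    (m * (2 * a' * r + r + a') - m ^ 2 * c' * (2 * a' + 1)) ?_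
  push_cast at h' ⊢
  have key : (Real.pi * I * b * (2 * (r : ℂ) + 1) ^ 2 / (4 * d) +
      (2 * Real.pi * I * m * ((r + 1 / 2) / d) - Real.pi * I * m ^ 2 * (c' + c') / d) -
      (Real.pi * I * b * (2 * (r + -(c' + c') * m) + 1) ^ 2 / (4 * d) + Real.pi * I * m)) =
      Real.pi * I * (m * (2 * r + 1) * ((1 + b * (c' + c')) / d) -
        m ^ 2 * (c' + c') * ((1 + b * (c' + c')) / d) - m) := by
    field_simp
    ring
  rw [key, h', mul_div_cancel_right₀ _ h0]
  ring

/-- The transformation of `thetaTwo` under a matrix with even lower left entry and odd positive lower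
right entry. The two square roots are kept apart: their quotient squares to `(c τ + d) / d`, and no
choice of branch for `(c τ + d)^{1/2}` is needed. -/
lemma thetaTwo_moebius {a b c : ℤ} {d : ℕ} (hd : Odd d) (hc : Even c) (h : a * d - b * c = 1)
    {τ : ℂ} (hτ : 0 < τ.im) (ht : 0 < (d * τ / (c * τ + d)).im) :
    thetaTwo ((a * τ + b) / (c * τ + d)) =
      thetaGauss b d * ((-I * τ) ^ (1 / 2 : ℂ) / (-I * (d * τ / (c * τ + d))) ^ (1 / 2 : ℂ)) *
        thetaTwo τ := by
  set t := d * τ / (c * τ + d) with htdef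
  have hd0 : (d : ℂ) ≠ 0 := by exact_mod_cast hd.pos.ne'
  have hτ0 : τ ≠ 0 := by rintro rfl; simp at hτ
  have hden : (c * τ + d : ℂ) ≠ 0 := by
    intro h0
    simp [htdef, h0] at ht
  have h' : (a * d - b * c : ℂ) = 1 := by exact_mod_cast h
  have hz : ((a * τ + b) / (c * τ + d) : ℂ) = b / d + t / d ^ 2 := by
    have htd : t * (c * τ + d) = d * τ := div_mul_cancel₀ _ hden
    rw [div_eq_iff hden, add_mul, div_mul_eq_mul_div t, htd]
    field_simp
    linear_combination τ * h'
  have hzim : 0 < (b / d + t / d ^ 2 : ℂ).im := by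
    have h1 : (b / d + t / d ^ 2 : ℂ) = ((b / d : ℝ) : ℂ) + ((1 / d ^ 2 : ℝ) : ℂ) * t := by
      push_cast; ring
    rw [h1, add_im, ofReal_im, im_ofReal_mul, zero_add]
    have : (0 : ℝ) < d := by exact_mod_cast hd.pos
    positivity
  have hinv : -1 / t = -c / d + -1 / τ := by
    rw [htdef]
    field_simp
    ring
  have hinvim : 0 < (-1 / τ).im := by
    rw [neg_div, neg_im, one_div, inv_im, neg_div, neg_neg]
    exact div_pos hτ (normSq_pos.2 hτ0)
  have hinvim' : 0 < (-1 / t).im := by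
    have ht0 : t ≠ 0 := by rintro h0; simp [h0] at ht
    rw [neg_div, neg_im, one_div, inv_im, neg_div, neg_neg]
    exact div_pos ht (normSq_pos.2 ht0)
  rw [hz, thetaTwo, tsum_int_eq_sum_residues (summable_exp_shifted_square _ hzim) d hd.pos]
  have inner : ∀ r ∈ Finset.range d,
      ∑' m : ℤ, cexp (Real.pi * I * (b / d + t / d ^ 2) * (((m * d + r : ℤ) : ℂ) + 1 / 2) ^ 2) =
      1 / (-I * t) ^ (1 / 2 : ℂ) * ∑' m : ℤ, thetaPhase b d r *
        cexp (2 * Real.pi * I * m * ((r + 1 / 2) / d) - Real.pi * I * m ^ 2 * c / d) *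
        cexp (Real.pi * I * m ^ 2 * (-1 / τ)) := by
    intro r _
    have h1 (m : ℤ) : cexp (Real.pi * I * (b / d + t / d ^ 2) *
        (((m * d + r : ℤ) : ℂ) + 1 / 2) ^ 2) =
        thetaPhase b d r * cexp (Real.pi * I * t * (m + (r + 1 / 2) / d) ^ 2) := by
      have h2 : thetaPhase b d r = thetaPhase b d (r + m * d) := by
        have hper : Function.Periodic (thetaPhase b d) (d : ℤ) := thetaPhase_add hd b
        exact (hper.int_mul m r).symm
      rw [h2, thetaPhase, ← Complex.exp_add]
      congr 1
      push_cast
      field_simp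
      ring
    simp_rw [h1]
    rw [tsum_mul_left, tsum_exp_shifted_square_poisson _ ht, hinv, mul_left_comm, jacobiTheta₂,
      ← tsum_mul_left]
    congr 1
    refine tsum_congr fun m => ?_
    rw [jacobiTheta₂_term, mul_assoc (thetaPhase b d r), ← Complex.exp_add]
    congr 2
    ring
  rw [Finset.sum_congr rfl inner, ← Finset.mul_sum, ← Summable.tsum_finsetSum]
  · simp_rw [← Finset.sum_mul, sum_thetaPhase_mul hd hc h]
    have h3 : ∑' m : ℤ, thetaGauss b d * cexp (Real.pi * I * m) *
        cexp (Real.pi * I * m ^ 2 * (-1 / τ)) = thetaGauss b d * jacobiTheta₂ (1 / 2) (-1 / τ) := by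
      rw [jacobiTheta₂, ← tsum_mul_left]
      refine tsum_congr fun m => ?_
      rw [jacobiTheta₂_term, mul_assoc, ← Complex.exp_add]
      congr 2
      ring
    rw [h3, jacobiTheta₂_half_neg_inv hτ]
    ring
  · intro r _
    have := ((summable_jacobiTheta₂_term_iff ((r + 1 / 2) / d) (-1 / t)).2 hinvim').mul_left
      (thetaPhase b d r)
    refine this.congr fun m => ?_
    rw [jacobiTheta₂_term, hinv, mul_assoc (thetaPhase b d r), ← Complex.exp_add]
    congr 2
    ring

/-! ### Evaluation of the Gauss sums at a prime -/

/-- A quadratic Gauss sum over `ℤ/p` as the Gauss sum of the quadratic character, obtained by counting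
square roots. -/
lemma sum_addChar_mul_sq {p : ℕ} [Fact p.Prime] (hp : p ≠ 2) (ψ : AddChar (ZMod p) ℂ)
    (hψ : ψ.IsPrimitive) {y : ZMod p} (hy : y ≠ 0) :
    ∑ s : ZMod p, ψ (y * s ^ 2) =
      (quadraticChar (ZMod p) y : ℂ) *
        gaussSum ((quadraticChar (ZMod p)).ringHomComp (Int.castRingHom ℂ)) ψ := by
  classical
  set χ := (quadraticChar (ZMod p)).ringHomComp (Int.castRingHom ℂ) with hχ
  have hchar : ringChar (ZMod p) ≠ 2 := by rwa [ZMod.ringChar_zmod_n]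
  have h1 : ∑ s : ZMod p, ψ (y * s ^ 2) = ∑ t : ZMod p, (χ t + 1) * ψ (y * t) := by
    rw [← Finset.sum_fiberwise (s := Finset.univ) (g := fun s : ZMod p => s ^ 2)]
    refine Finset.sum_congr rfl fun t _ => ?_
    have h2 : ∀ s ∈ Finset.univ.filter (fun s : ZMod p => s ^ 2 = t), ψ (y * s ^ 2) = ψ (y * t) := by
      intro s hs
      rw [(Finset.mem_filter.1 hs).2]
    rw [Finset.sum_congr rfl h2, Finset.sum_const, nsmul_eq_mul]
    congr 1
    have h3 := quadraticChar_card_sqrts hchar t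
    rw [Set.toFinset_ofPred] at h3
    have h4 : (((Finset.univ.filter (fun s : ZMod p => s ^ 2 = t)).card : ℤ) : ℂ) =
        ((quadraticChar (ZMod p) t + 1 : ℤ) : ℂ) := by rw [← h3]
    rw [hχ]
    simpa using h4
  have h5 : ∑ t : ZMod p, ψ (y * t) = 0 := by
    have := AddChar.sum_mulShift y hψ
    simp only [mul_comm _ y, if_neg hy] at this
    exact_mod_cast this
  rw [h1]
  simp_rw [add_mul, one_mul]
  rw [Finset.sum_add_distrib, h5, add_zero]
  have h6 := gaussSum_mulShift χ ψ (Units.mk0 y hy)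
  have h7 : χ y * χ y = 1 := by
    rw [hχ]
    simp only [MulChar.ringHomComp_apply, eq_intCast]
    rw [← Int.cast_mul, ← sq, quadraticChar_sq_one hy, Int.cast_one]
  have h8 : (quadraticChar (ZMod p) y : ℂ) = χ y := by simp [hχ]
  rw [h8, ← h6, ← mul_assoc, Units.val_mk0, h7, one_mul]
  rfl

lemma sum_range_zmod {p : ℕ} [NeZero p] (f : ZMod p → ℂ) :
    ∑ r ∈ Finset.range p, f (r : ZMod p) = ∑ s : ZMod p, f s := by
  refine Finset.sum_bij (fun r _ => (r : ZMod p)) (fun _ _ => Finset.mem_univ _) ?_ ?_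
    fun _ _ => rfl
  · intro r hr s hs h
    have h' := (ZMod.natCast_eq_natCast_iff' r s p).1 h
    rwa [Nat.mod_eq_of_lt (Finset.mem_range.1 hr), Nat.mod_eq_of_lt (Finset.mem_range.1 hs)] at h'
  · intro s _
    exact ⟨s.val, Finset.mem_range.2 s.val_lt, by simp⟩

/-- Completing the Gauss sum at a prime: the prefactor comes from replacing the odd numbers `2r + 1` by
`2r + p`, after which the sum runs over squares in `ℤ/p`. -/
lemma thetaGauss_prime {p : ℕ} [Fact p.Prime] (hp : p ≠ 2) {x : ℤ} (hx : (x : ZMod p) ≠ 0) :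
    thetaGauss x p = cexp (Real.pi * I * x * p / 4) * ((legendreSym p x : ℂ) *
      ((legendreSym p 2 : ℂ) * gaussSum ((quadraticChar (ZMod p)).ringHomComp (Int.castRingHom ℂ))
        ZMod.stdAddChar)) := by
  have hodd : Odd p := (Fact.out : p.Prime).odd_of_ne_two hp
  have h2 : (2 : ZMod p) ≠ 0 := by
    have : ringChar (ZMod p) ≠ 2 := by rwa [ZMod.ringChar_zmod_n]
    exact Ring.two_ne_zero this
  have hp0 : (p : ℂ) ≠ 0 := by exact_mod_cast hodd.pos.ne'
  obtain ⟨e, he⟩ := hodd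
  have hy2 : (x : ZMod p) * 2⁻¹ ≠ 0 := mul_ne_zero hx (inv_ne_zero h2)
  have hq : (quadraticChar (ZMod p) ((x : ZMod p) * 2⁻¹) : ℂ) =
      (legendreSym p x : ℂ) * (legendreSym p 2 : ℂ) := by
    rw [← Int.cast_mul, ← legendreSym.mul, legendreSym]
    have : ((x * 2 : ℤ) : ZMod p) = x * 2⁻¹ * 2 ^ 2 := by
      push_cast
      field_simp
    rw [this, map_mul _ (_ * _), quadraticChar_sq_one' h2, mul_one]
  rw [← mul_assoc (legendreSym p x : ℂ), ← hq,
    ← sum_addChar_mul_sq hp _ (ZMod.isPrimitive_stdAddChar p) hy2,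
    ← sum_range_zmod (fun s => ZMod.stdAddChar ((x : ZMod p) * 2⁻¹ * s ^ 2)), thetaGauss,
    -- The shift by `e = (p - 1) / 2` turns `2r + 1` into `2r + p`.
    ← sum_range_shift_of_periodic (thetaPhase_add ⟨e, he⟩ x) e, Finset.mul_sum]
  refine Finset.sum_congr rfl fun r _ => ?_
  obtain ⟨j, hj⟩ : Even ((r : ℤ) * (r + p)) := by
    rw [he]
    push_cast
    rcases Int.even_or_odd (r : ℤ) with h | h
    · exact h.mul_right _
    · exact (h.add_odd ⟨e, rfl⟩).mul_left _
  have hz : (x : ZMod p) * 2⁻¹ * (r : ZMod p) ^ 2 = ((x * j : ℤ) : ZMod p) := by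
    have h' : (((r : ℤ) * (r + p) : ℤ) : ZMod p) = ((j + j : ℤ) : ZMod p) := by rw [hj]
    push_cast at h' ⊢
    rw [ZMod.natCast_self, add_zero] at h'
    rw [sq, h']
    field_simp
    ring
  have h' : ((r : ℂ) * (r + p)) = j + j := by exact_mod_cast congrArg (Int.cast : ℤ → ℂ) hj
  rw [hz, ZMod.stdAddChar_coe, thetaPhase, ← Complex.exp_add]
  congr 1
  have hpe : (p : ℂ) = 2 * e + 1 := by exact_mod_cast congrArg (Nat.cast : ℕ → ℂ) he
  push_cast
  have h3 : (2 * ((r : ℂ) + e) + 1) = 2 * r + p := by rw [hpe]; ring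
  rw [h3]
  field_simp
  linear_combination 4 * (x : ℂ) * h'

lemma thetaGauss_one (x : ℤ) : thetaGauss x 1 = cexp (Real.pi * I * x / 4) := by
  simp [thetaGauss, thetaPhase]

lemma exp_eighth_eq_one {n : ℤ} (h : 8 ∣ n) : cexp (Real.pi * I * n / 4) = 1 := by
  obtain ⟨m, rfl⟩ := h
  rw [Complex.exp_eq_one_iff]
  refine ⟨m, ?_⟩
  push_cast
  ring

lemma prod_exp_eighth {k : ℕ} {c : Fin k → ℕ} (h8 : 8 ∣ ∑ j, c j) (b : ℤ) (d : ℕ) :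
    ∏ j, cexp (Real.pi * I * (b * c j : ℤ) * d / 4) = 1 := by
  rw [← Complex.exp_sum]
  have : (8 : ℤ) ∣ b * (∑ j, c j : ℕ) * d :=
    Dvd.dvd.mul_right (Dvd.dvd.mul_left (by exact_mod_cast h8) _) _
  rw [← exp_eighth_eq_one this]
  congr 1
  push_cast
  simp_rw [Finset.mul_sum, Finset.sum_mul, Finset.mul_sum, Finset.sum_div]
  exact Finset.sum_congr rfl fun _ _ => by ring

/-- The product of an even number of Gauss sums involves only even powers of the Gauss sum of the
quadratic character, so that its sign is irrelevant. -/
lemma prod_thetaGauss_prime {p : ℕ} [Fact p.Prime] (hp : p ≠ 2) {k : ℕ} (hk : Even k)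
    {c : Fin k → ℕ} (h8 : 8 ∣ ∑ j, c j) {b : ℤ} (hb : (b : ZMod p) ≠ 0)
    (hc : ∀ j, (c j : ZMod p) ≠ 0) :
    ∏ j, thetaGauss (b * c j) p =
      (legendreSym p ((-1) ^ (k / 2) * 4 * ∏ j, (c j : ℤ)) : ℂ) * (p : ℂ) ^ (k / 2) := by
  have hchar : ringChar (ZMod p) ≠ 2 := by rwa [ZMod.ringChar_zmod_n]
  have h2 : (2 : ZMod p) ≠ 0 := Ring.two_ne_zero hchar
  set χ := (quadraticChar (ZMod p)).ringHomComp (Int.castRingHom ℂ) with hχ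
  set g := gaussSum χ (ZMod.stdAddChar (N := p)) with hg
  have hx (j) : ((b * c j : ℤ) : ZMod p) ≠ 0 := by
    push_cast
    exact mul_ne_zero hb (hc j)
  have hsq : g ^ 2 = (legendreSym p (-1) : ℂ) * p := by
    rw [hg, gaussSum_sq _ _ (ZMod.isPrimitive_stdAddChar p)]
    · simp [hχ, legendreSym]
    · rw [hχ]
      intro h
      exact (MulChar.ringHomComp_ne_one_iff (f := Int.castRingHom ℂ) Int.cast_injective).2
        (quadraticChar_ne_one hchar) h
    · exact (quadraticChar_isQuadratic (ZMod p)).comp _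
  obtain ⟨l, rfl⟩ := hk
  have hl : (l + l) / 2 = l := by omega
  have hb2 : (legendreSym p b : ℂ) ^ 2 = 1 := by exact_mod_cast legendreSym.sq_one p hb
  have h22 : (legendreSym p 2 : ℂ) ^ 2 = 1 := by
    exact_mod_cast legendreSym.sq_one p (a := 2) (by exact_mod_cast h2)
  have h4 : legendreSym p 4 = 1 := by
    have := legendreSym.sq_one' p (a := 2) (by exact_mod_cast h2)
    simpa using this
  have hprod : (legendreSym p (∏ j, (c j : ℤ)) : ℂ) = ∏ j, (legendreSym p (c j) : ℂ) := by
    have : legendreSym p (∏ j, (c j : ℤ)) = ∏ j, legendreSym p (c j) :=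
      map_prod (legendreSym.hom p) _ _
    rw [this]
    push_cast
    rfl
  have hneg : legendreSym p ((-1) ^ l) = legendreSym p (-1) ^ l :=
    map_pow (legendreSym.hom p) _ _
  simp_rw [thetaGauss_prime hp (hx _)]
  rw [Finset.prod_mul_distrib, prod_exp_eighth h8, one_mul, Finset.prod_mul_distrib,
    Finset.prod_const, Finset.card_univ, Fintype.card_fin, hl, legendreSym.mul, legendreSym.mul,
    h4, hneg]
  simp_rw [legendreSym.mul p b, Int.cast_mul]
  rw [Finset.prod_mul_distrib, Finset.prod_const, Finset.card_univ, Fintype.card_fin, hprod,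
    pow_add, ← mul_pow, ← sq, hb2, pow_add, ← mul_pow _ _ l, ← sq, mul_pow (legendreSym p 2 : ℂ),
    h22, hsq]
  push_cast
  ring

/-! ### Automorphy factors and products of theta constants -/

/-- The automorphy factor `j(γ, τ) = c τ + d` of an integral matrix with lower row `(c, d)`. -/
def autFactor (γ : SL(2, ℤ)) (τ : ℍ) : ℂ := (γ 1 0 : ℤ) * (τ : ℂ) + (γ 1 1 : ℤ)

lemma autFactor_eq_denom (γ : SL(2, ℤ)) (τ : ℍ) : autFactor γ τ = UpperHalfPlane.denom γ τ :=
  (ModularGroup.denom_apply γ τ).symm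

lemma autFactor_ne_zero (γ : SL(2, ℤ)) (τ : ℍ) : autFactor γ τ ≠ 0 := by
  rw [autFactor_eq_denom]
  exact UpperHalfPlane.denom_ne_zero _ τ

lemma coe_smul_eq (γ : SL(2, ℤ)) (τ : ℍ) :
    ((γ • τ : ℍ) : ℂ) = ((γ 0 0 : ℤ) * (τ : ℂ) + (γ 0 1 : ℤ)) / autFactor γ τ := by
  rw [UpperHalfPlane.coe_specialLinearGroup_apply]
  simp [autFactor]

lemma autFactor_mul (γ δ : SL(2, ℤ)) (τ : ℍ) :
    autFactor (γ * δ) τ = autFactor γ (δ • τ) * autFactor δ τ := by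
  have h := autFactor_ne_zero δ τ
  rw [autFactor, autFactor, coe_smul_eq]
  simp only [Matrix.SpecialLinearGroup.coe_mul, Matrix.mul_apply, Fin.sum_univ_two]
  field_simp
  rw [autFactor]
  push_cast
  ring

/-- `F(γτ) = ε j(γ, τ)^w F(τ)` for all `τ`: the function `F` has weight `w` and multiplier `ε` at the
single matrix `γ`. -/
def TransformsWith (F : ℍ → ℂ) (w : ℕ) (ε : ℂ) (γ : SL(2, ℤ)) : Prop :=
  ∀ τ : ℍ, F (γ • τ) = ε * autFactor γ τ ^ w * F τ

lemma TransformsWith.mul {F : ℍ → ℂ} {w : ℕ} {ε ε' : ℂ} {γ δ : SL(2, ℤ)}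
    (h : TransformsWith F w ε γ) (h' : TransformsWith F w ε' δ) :
    TransformsWith F w (ε * ε') (γ * δ) := by
  intro τ
  rw [mul_smul, h, h', autFactor_mul]
  ring

/-- The lower unipotent matrix `(1, 0; s, 1)`. -/
def lowerUnipotent (s : ℤ) : SL(2, ℤ) := ⟨!![1, 0; s, 1], by simp⟩

lemma coe_lowerUnipotent (s : ℤ) :
    (lowerUnipotent s : Matrix (Fin 2) (Fin 2) ℤ) = !![1, 0; s, 1] := rfl

/-- The product of the theta constants `thetaTwo (c j * τ)`, on the upper half plane. -/
def thetaProd {k : ℕ} (c : Fin k → ℕ) (τ : ℍ) : ℂ := ∏ j, thetaTwo (c j * τ)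

lemma ofReal_mul_cpow {r : ℝ} (hr : 0 < r) {x : ℂ} (hx : x ≠ 0) (s : ℂ) :
    (r * x) ^ s = (r : ℂ) ^ s * x ^ s := by
  have hr0 : (r : ℂ) ≠ 0 := by exact_mod_cast hr.ne'
  rw [cpow_def_of_ne_zero (mul_ne_zero hr0 hx), cpow_def_of_ne_zero hr0, cpow_def_of_ne_zero hx,
    log_ofReal_mul hr hx, ofReal_log hr.le, add_mul, Complex.exp_add]

lemma det_eq_one (γ : SL(2, ℤ)) : γ 0 0 * γ 1 1 - γ 0 1 * γ 1 0 = 1 := by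
  have := γ.det_coe
  rwa [Matrix.det_fin_two] at this

lemma im_mul_div_autFactor_pos {γ : SL(2, ℤ)} {d : ℕ} (hd : 0 < d) (hγ : γ 1 1 = d) (τ : ℍ) :
    0 < (d * (τ : ℂ) / autFactor γ τ).im := by
  have h : (d * (τ : ℂ) / autFactor γ τ).im =
      (d : ℝ) ^ 2 * τ.im / normSq (autFactor γ τ) := by
    rw [div_im, autFactor, hγ]
    simp
    ring
  rw [h]
  have h1 : 0 < normSq (autFactor γ τ) := normSq_pos.2 (autFactor_ne_zero γ τ)
  have h2 : (0 : ℝ) < d := by exact_mod_cast hd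
  have := τ.im_pos
  positivity

/-- `thetaTwo (c j * γτ)` is the transform of `thetaTwo` at `c j * τ` under `(a, b c_j; c/c_j, d)`. The
quotient of square roots is the same for every `j`, since positive factors can be pulled out of the
principal branch. -/
lemma thetaProd_transformsWith {k : ℕ} (hk : Even k) {c : Fin k → ℕ} (hc : ∀ j, 0 < c j)
    {γ : SL(2, ℤ)} {d : ℕ} (hd : Odd d) (hγ : γ 1 1 = d) (hdvd : ∀ j, (2 * c j : ℤ) ∣ γ 1 0) :
    TransformsWith (thetaProd c) (k / 2)
      ((∏ j, thetaGauss (γ 0 1 * c j) d) / (d : ℂ) ^ (k / 2)) γ := by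
  intro τ
  set t : ℂ := d * (τ : ℂ) / autFactor γ τ with ht
  have hd0 : (d : ℂ) ≠ 0 := by exact_mod_cast hd.pos.ne'
  have hj0 := autFactor_ne_zero γ τ
  have htim : 0 < t.im := im_mul_div_autFactor_pos hd.pos hγ τ
  have hτ0 : (τ : ℂ) ≠ 0 := τ.ne_zero
  have ht0 : t ≠ 0 := by rintro h0; simp [h0] at htim
  set ρ : ℂ := (-I * τ) ^ (1 / 2 : ℂ) / (-I * t) ^ (1 / 2 : ℂ) with hρ
  have hfac (j) : thetaTwo (c j * ((γ • τ : ℍ) : ℂ)) =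
      thetaGauss (γ 0 1 * c j) d * ρ * thetaTwo (c j * τ) := by
    obtain ⟨e, he⟩ := hdvd j
    have hcr : (0 : ℝ) < c j := by exact_mod_cast hc j
    have hcpos : ((c j : ℝ) : ℂ) ≠ 0 := by exact_mod_cast hcr.ne'
    have hdet : γ 0 0 * d - γ 0 1 * c j * (2 * e) = 1 := by
      have := det_eq_one γ
      rw [hγ, he] at this
      linear_combination this
    have hj : ((2 * e : ℤ) : ℂ) * (c j * (τ : ℂ)) + d = autFactor γ τ := by
      rw [autFactor, hγ, he]
      push_cast
      ring
    have htj : d * (c j * (τ : ℂ)) / (((2 * e : ℤ) : ℂ) * (c j * (τ : ℂ)) + d) =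
        (c j : ℝ) * t := by
      rw [hj, ht]
      push_cast
      ring
    have him : 0 < (c j * (τ : ℂ)).im := by
      have : (c j * (τ : ℂ)) = ((c j : ℝ) : ℂ) * τ := by push_cast; rfl
      rw [this, im_ofReal_mul]
      exact mul_pos hcr τ.im_pos
    have hmain := thetaTwo_moebius hd (even_two_mul e) hdet him (by
      rw [htj, im_ofReal_mul]
      exact mul_pos hcr htim)
    have harg : c j * ((γ • τ : ℍ) : ℂ) =
        ((γ 0 0 : ℤ) * (c j * (τ : ℂ)) + ((γ 0 1 * c j : ℤ) : ℂ)) /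
          (((2 * e : ℤ) : ℂ) * (c j * (τ : ℂ)) + d) := by
      rw [hj, coe_smul_eq]
      push_cast
      ring
    rw [harg, hmain, htj]
    congr 2
    have h1 : -I * (c j * (τ : ℂ)) = (c j : ℝ) * (-I * τ) := by push_cast; ring
    have h2 : -I * ((c j : ℝ) * t) = (c j : ℝ) * (-I * t) := by ring
    rw [h1, h2, ofReal_mul_cpow hcr (by simp [hτ0]), ofReal_mul_cpow hcr (by simp [ht0]), hρ,
      mul_div_mul_left]
    rw [Complex.cpow_ne_zero_iff]
    exact Or.inl hcpos
  have hρ2 : ρ ^ 2 = autFactor γ τ / d := by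
    have hsq (x : ℂ) : (x ^ (1 / 2 : ℂ)) ^ 2 = x := by
      rw [← cpow_nat_mul]
      norm_num
    rw [hρ, div_pow, hsq, hsq, ht]
    field_simp [I_ne_zero]
  obtain ⟨l, rfl⟩ := hk
  have hl : (l + l) / 2 = l := by omega
  rw [thetaProd, Finset.prod_congr rfl fun j _ => hfac j, Finset.prod_mul_distrib,
    Finset.prod_mul_distrib, Finset.prod_const, Finset.card_univ, Fintype.card_fin, pow_add,
    ← mul_pow, ← sq, hρ2, hl, thetaProd, div_pow]
  ring

lemma thetaProd_add_int {k : ℕ} {c : Fin k → ℕ} (h8 : 8 ∣ ∑ j, c j) (n : ℤ) :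
    TransformsWith (thetaProd c) (k / 2) 1 (ModularGroup.T ^ n) := by
  intro τ
  have h1 : autFactor (ModularGroup.T ^ n) τ = 1 := by
    simp [autFactor, ModularGroup.coe_T_zpow]
  have h2 (j) : thetaTwo (c j * ((ModularGroup.T ^ n • τ : ℍ) : ℂ)) =
      cexp (Real.pi * I * (n * c j : ℤ) * (1 : ℕ) / 4) * thetaTwo (c j * τ) := by
    rw [ModularGroup.coe_T_zpow_smul_eq, thetaTwo, thetaTwo, ← tsum_mul_left]
    refine tsum_congr fun m => ?_
    rw [← Complex.exp_add]
    obtain ⟨e, he⟩ := Int.even_mul_succ_self m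
    have he' : (m * (m + 1) : ℂ) = e + e := by exact_mod_cast congrArg (Int.cast : ℤ → ℂ) he
    refine exp_eq_of_sub_eq (c j * n * e) ?_
    push_cast
    linear_combination Real.pi * I * c j * n * he'
  rw [thetaProd, Finset.prod_congr rfl fun j _ => h2 j, Finset.prod_mul_distrib,
    prod_exp_eighth h8, h1, thetaProd]
  simp

/-- The case `d = 1` of `thetaProd_transformsWith`, in which all Gauss sums are equal to `1`. -/
lemma thetaProd_lowerUnipotent {k : ℕ} (hk : Even k) {c : Fin k → ℕ} (hc : ∀ j, 0 < c j)
    {s : ℤ} (hs : ∀ j, (2 * c j : ℤ) ∣ s) :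
    TransformsWith (thetaProd c) (k / 2) 1 (lowerUnipotent s) := by
  have h := thetaProd_transformsWith hk hc (γ := lowerUnipotent s) odd_one (by simp [coe_lowerUnipotent])
    (by simpa [coe_lowerUnipotent] using hs)
  have h1 : ∏ j, thetaGauss ((lowerUnipotent s) 0 1 * c j) 1 = 1 := by
    simp [coe_lowerUnipotent, thetaGauss_one]
  rw [h1] at h
  simpa using h

lemma thetaProd_prime {k : ℕ} (hk : Even k) {c : Fin k → ℕ} (hc : ∀ j, 0 < c j)
    (h8 : 8 ∣ ∑ j, c j) {γ : SL(2, ℤ)} {p : ℕ} [Fact p.Prime] (hp : p ≠ 2) (hγ : γ 1 1 = p)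
    (hdvd : ∀ j, (2 * c j : ℤ) ∣ γ 1 0) :
    TransformsWith (thetaProd c) (k / 2)
      (legendreSym p ((-1) ^ (k / 2) * 4 * ∏ j, (c j : ℤ)) : ℂ) γ := by
  have hpp : p.Prime := Fact.out
  have hdet : (γ 0 1 : ZMod p) * (γ 1 0 : ZMod p) = -1 := by
    have := congrArg (Int.cast : ℤ → ZMod p) (det_eq_one γ)
    rw [hγ] at this
    push_cast at this
    rw [ZMod.natCast_self, mul_zero, zero_sub] at this
    rw [← this, neg_neg]
  have hb : (γ 0 1 : ZMod p) ≠ 0 := by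
    intro h
    simp [h] at hdet
  have hcp (j) : (c j : ZMod p) ≠ 0 := by
    intro h
    obtain ⟨e, he⟩ := hdvd j
    rw [he] at hdet
    push_cast at hdet
    simp [h] at hdet
  have h := thetaProd_transformsWith hk hc (hpp.odd_of_ne_two hp) hγ hdvd
  rw [prod_thetaGauss_prime hp hk h8 hb hcp, mul_div_assoc, div_self, mul_one] at h
  · exact h
  · exact pow_ne_zero _ (by exact_mod_cast hpp.ne_zero)

/-! ### The multiplier of the theta product for all lower rows -/

lemma kroneckerSym_of_odd (A : ℤ) {d : ℤ} (hd : Odd d) :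
    kroneckerSym A d = (if A < 0 ∧ d < 0 then -1 else 1) * jacobiSym A d.natAbs := by
  have hd0 : d ≠ 0 := by rintro rfl; simp at hd
  have hv : padicValNat 2 d.natAbs = 0 := by
    refine padicValNat.eq_zero_of_not_dvd ?_
    rw [← even_iff_two_dvd, Nat.not_even_iff_odd]
    exact Int.natAbs_odd.2 hd
  rw [kroneckerSym, if_neg hd0, hv]
  simp

lemma kroneckerSym_mul (A : ℤ) {d e : ℤ} (hd : Odd d) (he : Odd e) :
    kroneckerSym A (d * e) = kroneckerSym A d * kroneckerSym A e := by
  have hd0 : d ≠ 0 := by rintro rfl; simp at hd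
  have he0 : e ≠ 0 := by rintro rfl; simp at he
  rw [kroneckerSym_of_odd A (hd.mul he), kroneckerSym_of_odd A hd, kroneckerSym_of_odd A he,
    Int.natAbs_mul, jacobiSym.mul_right' A (Int.natAbs_ne_zero.2 hd0) (Int.natAbs_ne_zero.2 he0)]
  rcases lt_or_gt_of_ne hd0 with h1 | h1 <;> rcases lt_or_gt_of_ne he0 with h2 | h2
  · have := mul_pos_of_neg_of_neg h1 h2
    by_cases hA : A < 0 <;> simp [h1, h2, hA, this.not_gt]
  · have := mul_neg_of_neg_of_pos h1 h2
    by_cases hA : A < 0 <;> simp [h1, h2.not_gt, hA, this]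
  · have := mul_neg_of_pos_of_neg h1 h2
    by_cases hA : A < 0 <;> simp [h1.not_gt, h2, hA, this]
  · have := mul_pos h1 h2
    simp [h1.not_gt, h2.not_gt, this.not_gt]

/-- The upper entry `(-1)^{k/2} 4 c_1 ⋯ c_k` of the symbol `triSymbol`. -/
def triDisc {k : ℕ} (c : Fin k → ℕ) : ℤ := (-1) ^ (k / 2) * 4 * ∏ j, (c j : ℤ)

lemma natAbs_triDisc {k : ℕ} (c : Fin k → ℕ) : ((triDisc c).natAbs : ℤ) = 4 * ∏ j, (c j : ℤ) := by
  have h : (0 : ℤ) ≤ 4 * ∏ j, (c j : ℤ) := by positivity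
  rw [triDisc, mul_assoc, Int.natAbs_mul, Int.natAbs_pow]
  simp [abs_of_nonneg h]

lemma triSymbol_neg_one {k : ℕ} {c : Fin k → ℕ} (hc : ∀ j, 0 < c j) :
    triSymbol c (-1) = (-1) ^ (k / 2) := by
  have h : (0 : ℤ) < 4 * ∏ j, (c j : ℤ) := by
    have : (0 : ℤ) < ∏ j, (c j : ℤ) := Finset.prod_pos fun j _ => by exact_mod_cast hc j
    positivity
  rw [triSymbol, kroneckerSym_of_odd _ (by decide), mul_assoc]
  rcases Nat.even_or_odd (k / 2) with he | ho
  · simp only [he.neg_one_pow, one_mul]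
    rw [if_neg (by omega)]
    simp
  · simp only [ho.neg_one_pow]
    rw [if_pos (by omega)]
    simp

lemma triSymbol_neg {k : ℕ} {c : Fin k → ℕ} (hc : ∀ j, 0 < c j) {d : ℤ} (hd : Odd d) :
    triSymbol c (-d) = (-1) ^ (k / 2) * triSymbol c d := by
  rw [← triSymbol_neg_one hc, triSymbol, triSymbol, triSymbol,
    ← kroneckerSym_mul _ (by decide) hd, neg_one_mul]

lemma triSymbol_natCast {k : ℕ} (c : Fin k → ℕ) {d : ℕ} (hd : Odd d) :
    triSymbol c d = jacobiSym (triDisc c) d := by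
  rw [triSymbol, kroneckerSym_of_odd _ (by exact_mod_cast hd), if_neg (by omega), one_mul]
  rfl

lemma isCoprime_lower_row (γ : SL(2, ℤ)) : IsCoprime (γ 1 0) (γ 1 1) :=
  ⟨-γ 0 1, γ 0 0, by linear_combination det_eq_one γ⟩

lemma mul_lowerUnipotent_lower_row (γ : SL(2, ℤ)) (s : ℤ) :
    (γ * lowerUnipotent s) 1 0 = γ 1 0 + γ 1 1 * s ∧ (γ * lowerUnipotent s) 1 1 = γ 1 1 := by
  simp [Matrix.SpecialLinearGroup.coe_mul, coe_lowerUnipotent, Matrix.mul_apply,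
      Fin.sum_univ_two]

lemma mul_T_zpow_lower_row (γ : SL(2, ℤ)) (n : ℤ) :
    (γ * ModularGroup.T ^ n) 1 0 = γ 1 0 ∧
      (γ * ModularGroup.T ^ n) 1 1 = γ 1 0 * n + γ 1 1 := by
  simp [ModularGroup.coe_T_zpow, Matrix.mul_apply, Fin.sum_univ_two]

lemma lowerUnipotent_mul (s t : ℤ) :
    lowerUnipotent s * lowerUnipotent t = lowerUnipotent (s + t) := by
  ext i j
  fin_cases i <;> fin_cases j <;>
    simp [Matrix.SpecialLinearGroup.coe_mul, coe_lowerUnipotent, Matrix.mul_apply,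
      Fin.sum_univ_two]

lemma lowerUnipotent_zero : lowerUnipotent 0 = 1 := by
  ext i j
  fin_cases i <;> fin_cases j <;> simp [coe_lowerUnipotent]

/-- The multiplier depends only on the class of the lower row under right multiplication by lower
unipotent matrices and translations. This allows the lower left entry to be made divisible by
`4 |triDisc c|` and then `d` to be made prime without changing the symbol. -/
lemma thetaProd_of_pos {k : ℕ} (hk : Even k) {c : Fin k → ℕ} (hc : ∀ j, 0 < c j)
    (h8 : 8 ∣ ∑ j, c j) {γ : SL(2, ℤ)} (hdvd : ∀ j, (2 * c j : ℤ) ∣ γ 1 0)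
    (hodd : Odd (γ 1 1)) (hpos : 0 < γ 1 1) :
    TransformsWith (thetaProd c) (k / 2) (triSymbol c (γ 1 1)) γ := by
  obtain ⟨d, hd⟩ := Int.eq_ofNat_of_zero_le hpos.le
  have hdodd : Odd d := by rw [hd] at hodd; exact_mod_cast hodd
  set N : ℤ := 4 * (triDisc c).natAbs with hN
  have hprodpos : (0 : ℤ) < ∏ j, (c j : ℤ) := Finset.prod_pos fun j _ => by exact_mod_cast hc j
  have hNpos : 0 < N := by
    rw [hN, natAbs_triDisc]
    positivity
  have hNdvd (j) : (2 * c j : ℤ) ∣ N := by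
    obtain ⟨e, he⟩ := Finset.dvd_prod_of_mem (fun j => (c j : ℤ)) (Finset.mem_univ j)
    exact ⟨8 * e, by rw [hN, natAbs_triDisc, he]; ring⟩
  have hcop : IsCoprime (γ 1 1) N := by
    rw [hN, natAbs_triDisc]
    have h2 : IsCoprime (γ 1 1) (2 : ℤ) := by
      obtain ⟨e, he⟩ := hodd
      exact ⟨1, -e, by rw [he]; ring⟩
    have h4 : IsCoprime (γ 1 1) (4 : ℤ) := by
      have := h2.mul_right h2
      norm_num at this
      exact this
    refine h4.mul_right (h4.mul_right (IsCoprime.prod_right fun j _ => ?_))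
    exact ((isCoprime_lower_row γ).symm).of_isCoprime_of_dvd_right
      ((Dvd.intro_left _ rfl).trans (hdvd j))
  obtain ⟨s, hs, hsN, hs0⟩ : ∃ s : ℤ, (∀ j, (2 * c j : ℤ) ∣ s) ∧ N ∣ γ 1 0 + γ 1 1 * s ∧
      γ 1 0 + γ 1 1 * s ≠ 0 := by
    obtain ⟨x, y, hxy⟩ := hcop
    have h1 : N ∣ γ 1 0 + γ 1 1 * (-γ 1 0 * x) := ⟨γ 1 0 * y, by linear_combination (-γ 1 0) * hxy⟩
    have h2 (j) : (2 * c j : ℤ) ∣ -γ 1 0 * x := ((hdvd j).neg_right).mul_right x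
    by_cases h0 : γ 1 0 + γ 1 1 * (-γ 1 0 * x) = 0
    -- A zero lower left entry would leave no room for translations.
    · refine ⟨-γ 1 0 * x + N, fun j => (h2 j).add (hNdvd j), ?_, ?_⟩
      · rw [mul_add, ← add_assoc]
        exact h1.add (dvd_mul_left _ _)
      · rw [mul_add, ← add_assoc, h0, zero_add]
        exact mul_ne_zero hpos.ne' hNpos.ne'
    · exact ⟨_, h2, h1, h0⟩
  obtain ⟨hr0, hr1⟩ := mul_lowerUnipotent_lower_row γ s
  set γ' := γ * lowerUnipotent s with hγ'
  have hc'cop : IsCoprime (γ 1 1) ((γ' 1 0).natAbs : ℤ) := by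
    have := (isCoprime_lower_row γ').symm
    rw [hr1] at this
    rw [Int.natCast_natAbs]
    exact this.abs_right
  obtain ⟨p, hp2, hpp, hpd⟩ := Nat.forall_exists_prime_gt_and_zmodEq 2
    (q := (γ' 1 0).natAbs) (a := γ 1 1) (by rw [hr0]; exact Int.natAbs_ne_zero.2 hs0) hc'cop
  have : Fact p.Prime := ⟨hpp⟩
  have hdvd' : γ' 1 0 ∣ p - γ 1 1 := Int.natAbs_dvd.1 hpd.symm.dvd
  obtain ⟨n, hn⟩ := hdvd'
  obtain ⟨ht0, ht1⟩ := mul_T_zpow_lower_row γ' n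
  have hδ : (γ' * ModularGroup.T ^ n) 1 1 = p := by
    rw [ht1, hr1]
    linear_combination -hn
  have hmain := thetaProd_prime hk hc h8 (γ := γ' * ModularGroup.T ^ n) (by omega) hδ (by
    intro j
    rw [ht0, hr0]
    exact (hdvd j).add ((hs j).mul_left _))
  have hsym : legendreSym p ((-1) ^ (k / 2) * 4 * ∏ j, (c j : ℤ)) = triSymbol c (γ 1 1) := by
    rw [hd, triSymbol_natCast c hdodd, jacobiSym.legendreSym.to_jacobiSym]
    change jacobiSym (triDisc c) p = _
    rw [jacobiSym.mod_right _ (hpp.odd_of_ne_two (by omega)), jacobiSym.mod_right _ hdodd]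
    have h1 : N ∣ (p : ℤ) - d := by
      rw [← hr0] at hsN
      rw [hd] at hn
      rw [hn]
      exact hsN.mul_right n
    have h2 : d ≡ p [MOD 4 * (triDisc c).natAbs] := by
      rw [← Int.natCast_modEq_iff]
      exact (Int.modEq_iff_dvd).2 (by rw [Nat.cast_mul]; exact h1)
    rw [h2]
  rw [hsym] at hmain
  have hback := (hmain.mul (thetaProd_add_int h8 (-n))).mul
    (thetaProd_lowerUnipotent hk hc (s := -s) fun j => (hs j).neg_right)
  rw [mul_one, mul_one, mul_assoc γ', ← zpow_add, add_neg_cancel, zpow_zero, mul_one, hγ',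
    mul_assoc, lowerUnipotent_mul, add_neg_cancel, lowerUnipotent_zero, mul_one] at hback
  exact hback

lemma autFactor_neg (γ : SL(2, ℤ)) (τ : ℍ) : autFactor (-γ) τ = -autFactor γ τ := by
  simp [autFactor]
  ring

/-- Negative `d` is reduced to positive `d` by passing to `-γ`: the sign `(-1)^{k/2}` of `j^{k/2}` is
the value of the character at `-1`. -/
lemma thetaProd_transforms {k : ℕ} (hk : Even k) (hk2 : 2 ≤ k) {c : Fin k → ℕ}
    (hc : ∀ j, 0 < c j) (h8 : 8 ∣ ∑ j, c j) {γ : SL(2, ℤ)}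
    (hdvd : ∀ j, (2 * c j : ℤ) ∣ γ 1 0) :
    TransformsWith (thetaProd c) (k / 2) (triSymbol c (γ 1 1)) γ := by
  have hodd : Odd (γ 1 1) := by
    obtain ⟨e, he⟩ := hdvd ⟨0, by omega⟩
    have h1 : Odd (γ 0 0 * γ 1 1) := by
      rw [sub_eq_iff_eq_add.1 (det_eq_one γ), he]
      exact odd_one.add_even (Even.mul_left (by rw [mul_assoc]; exact even_two_mul _) _)
    exact (Int.odd_mul.1 h1).2
  rcases lt_trichotomy (γ 1 1) 0 with h | h | h
  · have h' := thetaProd_of_pos hk hc h8 (γ := -γ) (fun j => by simpa using hdvd j)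
      (by simpa using hodd) (by simpa using h)
    intro τ
    have h2 := h' τ
    have h3 : (-γ) 1 1 = -γ 1 1 := by simp
    rw [ModularGroup.SL_neg_smul, autFactor_neg, h3, triSymbol_neg hc hodd] at h2
    rw [h2, neg_pow]
    push_cast
    have h4 : ((-1 : ℂ) ^ (k / 2)) * (-1) ^ (k / 2) = 1 := by rw [← mul_pow]; simp
    linear_combination (triSymbol c (γ 1 1) : ℂ) * autFactor γ τ ^ (k / 2) * thetaProd c τ * h4
  · simp [h] at hodd
  · exact thetaProd_of_pos hk hc h8 hdvd hodd h

/-! ### The hexagonal theta function on `Γ₀(3)` -/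

lemma nome_ne_zero (τ : ℂ) : nome τ ≠ 0 := Complex.exp_ne_zero _

lemma nome_zpow (τ : ℂ) (n : ℤ) : nome τ ^ n = cexp (2 * Real.pi * I * τ * n) := by
  rw [nome, ← Complex.exp_int_mul]
  congr 1
  ring

lemma norm_nome (τ : ℂ) : ‖nome τ‖ = Real.exp (-2 * Real.pi * τ.im) := by
  rw [nome, Complex.norm_exp]
  congr 1
  simp

lemma norm_nome_lt_one {τ : ℂ} (hτ : 0 < τ.im) : ‖nome τ‖ < 1 := by
  rw [norm_nome, Real.exp_lt_one_iff]
  nlinarith [Real.pi_pos]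

/-- A product of two Gaussians, which dominates the terms of `hexTheta` because
`m² + m n + n² ≥ (m² + n²) / 2`. -/
def hexBound (y : ℝ) (p : ℤ × ℤ) : ℝ :=
  Real.exp (-Real.pi * y * p.1 ^ 2) * Real.exp (-Real.pi * y * p.2 ^ 2)

lemma summable_gaussian {y : ℝ} (hy : 0 < y) :
    Summable fun n : ℤ => Real.exp (-Real.pi * y * n ^ 2) := by
  have h := ((summable_jacobiTheta₂_term_iff 0 (I * y)).2 (by simpa using hy)).norm
  refine h.congr fun n => ?_
  rw [norm_jacobiTheta₂_term]
  congr 1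
  simp
  ring

lemma summable_hexBound {y : ℝ} (hy : 0 < y) : Summable (hexBound y) :=
  (summable_gaussian hy).mul_of_nonneg (summable_gaussian hy) (fun _ => (Real.exp_pos _).le)
    fun _ => (Real.exp_pos _).le

lemma norm_hex_term_le {y : ℝ} (hy : 0 < y) {τ : ℂ} (hτ : y ≤ τ.im) (p : ℤ × ℤ) :
    ‖nome τ ^ (p.1 ^ 2 + p.1 * p.2 + p.2 ^ 2)‖ ≤ hexBound y p := by
  rw [nome_zpow, Complex.norm_exp, hexBound, ← Real.exp_add, Real.exp_le_exp]
  have h0 : (2 * Real.pi * I * τ * ((p.1 ^ 2 + p.1 * p.2 + p.2 ^ 2 : ℤ) : ℂ)).re =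
      -(2 * Real.pi * τ.im * ((p.1 ^ 2 + p.1 * p.2 + p.2 ^ 2 : ℤ) : ℝ)) := by
    have : (2 * Real.pi * I * τ * ((p.1 ^ 2 + p.1 * p.2 + p.2 ^ 2 : ℤ) : ℂ)) =
        ((2 * Real.pi * ((p.1 ^ 2 + p.1 * p.2 + p.2 ^ 2 : ℤ) : ℝ) : ℝ) : ℂ) * (I * τ) := by
      push_cast; ring
    rw [this, re_ofReal_mul, I_mul_re]
    ring
  rw [h0]
  push_cast
  have h1 : (0 : ℝ) ≤ (p.1 : ℝ) ^ 2 + p.1 * p.2 + p.2 ^ 2 := by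
    nlinarith [sq_nonneg ((p.1 : ℝ) + p.2), sq_nonneg (p.1 : ℝ), sq_nonneg (p.2 : ℝ)]
  have h2 : Real.pi * y * (p.1 ^ 2 + p.2 ^ 2) ≤
      2 * Real.pi * y * ((p.1 : ℝ) ^ 2 + p.1 * p.2 + p.2 ^ 2) := by
    have : 0 ≤ Real.pi * y * ((p.1 : ℝ) + p.2) ^ 2 := by positivity
    nlinarith
  have h3 := mul_le_mul_of_nonneg_left hτ (mul_nonneg Real.two_pi_pos.le h1)
  nlinarith

lemma summable_hex {τ : ℂ} (hτ : 0 < τ.im) :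
    Summable fun p : ℤ × ℤ => nome τ ^ (p.1 ^ 2 + p.1 * p.2 + p.2 ^ 2) :=
  Summable.of_norm_bounded (summable_hexBound hτ) fun p => norm_hex_term_le hτ le_rfl p

lemma hexTheta_add_int (τ : ℂ) (n : ℤ) : hexTheta (τ + n) = hexTheta τ := by
  have : nome (τ + n) = nome τ := exp_eq_of_sub_eq n (by ring)
  rw [hexTheta, hexTheta, this]

lemma hexTheta_eq_tsum_tsum {τ : ℂ} (hτ : 0 < τ.im) :
    hexTheta τ = ∑' m : ℤ, ∑' n : ℤ, nome τ ^ (m ^ 2 + m * n + n ^ 2) :=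
  (summable_hex hτ).tsum_prod

/-- Poisson summation in the first variable. -/
lemma tsum_hex_row {τ : ℂ} (hτ : 0 < τ.im) (n : ℤ) :
    ∑' m : ℤ, nome τ ^ (m ^ 2 + m * n + n ^ 2) =
      1 / (-I * (2 * τ)) ^ (1 / 2 : ℂ) * ∑' m : ℤ,
        jacobiTheta₂_term m 0 (-1 / (2 * τ)) * jacobiTheta₂_term n (m / 2) (3 / 2 * τ) := by
  have h2 : 0 < (2 * τ).im := by simpa using hτ
  have h5 (m : ℤ) : nome τ ^ (m ^ 2 + m * n + n ^ 2) =
      cexp (Real.pi * I * (3 / 2 * τ) * n ^ 2) *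
        cexp (Real.pi * I * (2 * τ) * (m + n / 2) ^ 2) := by
    rw [nome_zpow, ← Complex.exp_add]
    congr 1
    push_cast
    ring
  simp_rw [h5]
  rw [tsum_mul_left, tsum_exp_shifted_square_poisson _ h2, mul_left_comm, jacobiTheta₂,
    ← tsum_mul_left]
  congr 1
  refine tsum_congr fun m => ?_
  simp only [jacobiTheta₂_term]
  rw [← Complex.exp_add, ← Complex.exp_add]
  congr 1
  ring

lemma summable_hex_dual {τ : ℂ} (hτ : 0 < τ.im) :
    Summable (Function.uncurry fun n m : ℤ =>
      jacobiTheta₂_term m 0 (-1 / (2 * τ)) * jacobiTheta₂_term n (m / 2) (3 / 2 * τ)) := by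
  have hτ0 : τ ≠ 0 := by rintro rfl; simp at hτ
  have h2 : 0 < (2 * τ).im := by simpa using hτ
  have h3 : 0 < (3 / 2 * τ).im := by
    have : (3 / 2 * τ : ℂ) = ((3 / 2 : ℝ) : ℂ) * τ := by push_cast; ring
    rw [this, im_ofReal_mul]
    positivity
  have h4 : 0 < (-1 / (2 * τ)).im := by
    rw [neg_div, neg_im, one_div, inv_im, neg_div, neg_neg]
    exact div_pos h2 (normSq_pos.2 (mul_ne_zero two_ne_zero hτ0))
  have hb := ((summable_jacobiTheta₂_term_iff 0 (3 / 2 * τ)).2 h3).norm.mul_of_nonneg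
    ((summable_jacobiTheta₂_term_iff 0 (-1 / (2 * τ))).2 h4).norm
    (fun _ => norm_nonneg _) (fun _ => norm_nonneg _)
  refine Summable.of_norm_bounded hb fun p => ?_
  have h6 : ((p.2 : ℂ) / 2).im = 0 := by
    have : ((p.2 : ℂ) / 2) = ((p.2 / 2 : ℝ) : ℂ) := by push_cast; rfl
    rw [this, ofReal_im]
  rw [Function.uncurry, norm_mul, mul_comm]
  refine mul_le_mul_of_nonneg_right ?_ (norm_nonneg _)
  rw [norm_jacobiTheta₂_term, norm_jacobiTheta₂_term, h6, zero_im]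

lemma hexTheta_eq_iterated_sum {τ : ℂ} (hτ : 0 < τ.im) :
    hexTheta τ = 1 / (-I * (2 * τ)) ^ (1 / 2 : ℂ) *
      ∑' m : ℤ, cexp (Real.pi * I * m ^ 2 * (-1 / (2 * τ))) * jacobiTheta₂ (m / 2) (3 / 2 * τ) := by
  have hsymm : hexTheta τ = ∑' n : ℤ, ∑' m : ℤ, nome τ ^ (m ^ 2 + m * n + n ^ 2) := by
    rw [hexTheta_eq_tsum_tsum hτ]
    refine tsum_congr fun n => tsum_congr fun m => ?_
    congr 1
    ring
  rw [hsymm, tsum_congr (tsum_hex_row hτ), tsum_mul_left,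
    ← Summable.tsum_comm (summable_hex_dual hτ)]
  congr 1
  refine tsum_congr fun m => ?_
  rw [tsum_mul_left, jacobiTheta₂]
  congr 1
  rw [jacobiTheta₂_term, mul_zero, zero_add]

/-- Poisson summation in the second variable completes the passage to the dual form, which is again
hexagonal after `n ↦ -n`. -/
lemma hexTheta_fricke {τ : ℂ} (hτ : 0 < τ.im) :
    hexTheta τ = 1 / (-I * (2 * τ)) ^ (1 / 2 : ℂ) * (1 / (-I * (3 / 2 * τ)) ^ (1 / 2 : ℂ)) *
      hexTheta (-1 / (3 * τ)) := by
  have hτ0 : τ ≠ 0 := by rintro rfl; simp at hτ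
  have h3 : 0 < (-1 / (3 * τ)).im := by
    rw [neg_div, neg_im, one_div, inv_im, neg_div, neg_neg]
    refine div_pos (by simpa using hτ) (normSq_pos.2 (by simpa using hτ0))
  have hassoc (A B C D : ℂ) : A * (B * C * D) = B * (A * (C * D)) := by ring
  rw [hexTheta_eq_iterated_sum hτ, mul_assoc]
  congr 1
  rw [hexTheta_eq_tsum_tsum h3, ← tsum_mul_left]
  refine tsum_congr fun m => ?_
  rw [← (Equiv.neg ℤ).tsum_eq (fun n : ℤ => nome (-1 / (3 * τ)) ^ (m ^ 2 + m * n + n ^ 2)),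
    jacobiTheta₂_functional_equation, hassoc]
  congr 1
  rw [jacobiTheta₂, ← tsum_mul_left, ← tsum_mul_left]
  refine tsum_congr fun n => ?_
  simp only [jacobiTheta₂_term, Equiv.neg_apply]
  rw [nome_zpow, ← Complex.exp_add, ← Complex.exp_add]
  congr 1
  push_cast
  field_simp
  ring

/-- The Fricke relation up to a constant; the value of the constant plays no role, as it cancels in
`hexTheta_lowerUnipotent`. -/
lemma exists_hexTheta_fricke :
    ∃ κ : ℂ, κ ≠ 0 ∧ ∀ τ : ℂ, 0 < τ.im → hexTheta (-1 / (3 * τ)) = κ * τ * hexTheta τ := by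
  have hne {x : ℂ} (hx : x ≠ 0) : x ^ (1 / 2 : ℂ) ≠ 0 := by
    rw [Complex.cpow_ne_zero_iff]
    exact Or.inl hx
  have h2 : ((2 : ℝ) : ℂ) ^ (1 / 2 : ℂ) ≠ 0 := hne (by norm_num)
  have h3 : ((3 / 2 : ℝ) : ℂ) ^ (1 / 2 : ℂ) ≠ 0 := hne (by norm_num)
  refine ⟨((2 : ℝ) : ℂ) ^ (1 / 2 : ℂ) * ((3 / 2 : ℝ) : ℂ) ^ (1 / 2 : ℂ) * -I,
    mul_ne_zero (mul_ne_zero h2 h3) (neg_ne_zero.2 I_ne_zero), fun τ hτ => ?_⟩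
  have hτ0 : τ ≠ 0 := by rintro rfl; simp at hτ
  have hI : -I * τ ≠ 0 := mul_ne_zero (neg_ne_zero.2 I_ne_zero) hτ0
  have hs := hne hI
  have hsq : ((-I * τ) ^ (1 / 2 : ℂ)) * ((-I * τ) ^ (1 / 2 : ℂ)) = -I * τ := by
    rw [← sq, ← cpow_nat_mul]
    norm_num
  have e2 : -I * (2 * τ) = (2 : ℝ) * (-I * τ) := by push_cast; ring
  have e3 : -I * (3 / 2 * τ) = ((3 / 2 : ℝ) : ℂ) * (-I * τ) := by push_cast; ring
  have h := hexTheta_fricke hτ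
  rw [e2, e3, ofReal_mul_cpow (by norm_num) hI, ofReal_mul_cpow (by norm_num) hI] at h
  rw [mul_assoc _ (-I), ← hsq, h]
  generalize ((2 : ℝ) : ℂ) ^ (1 / 2 : ℂ) = A at *
  generalize ((3 / 2 : ℝ) : ℂ) ^ (1 / 2 : ℂ) = B at *
  generalize (-I * τ) ^ (1 / 2 : ℂ) = s at *
  field_simp

lemma coe_lowerUnipotent_smul (s : ℤ) (τ : ℍ) :
    ((lowerUnipotent s • τ : ℍ) : ℂ) = τ / (s * τ + 1) ∧
      autFactor (lowerUnipotent s) τ = s * τ + 1 := by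
  have h : autFactor (lowerUnipotent s) τ = s * τ + 1 := by
    simp [autFactor, coe_lowerUnipotent]
  refine ⟨?_, h⟩
  rw [coe_smul_eq, h]
  simp [coe_lowerUnipotent]

/-- The map `τ ↦ τ / (3 n τ + 1)` becomes the translation by `-n` after conjugation with the Fricke
involution `τ ↦ -1 / (3 τ)`. -/
lemma hexTheta_lowerUnipotent (n : ℤ) :
    TransformsWith (fun τ => hexTheta τ) 1 1 (lowerUnipotent (3 * n)) := by
  intro τ
  obtain ⟨κ, hκ, h⟩ := exists_hexTheta_fricke
  obtain ⟨h1, h2⟩ := coe_lowerUnipotent_smul (3 * n) τ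
  have hj := autFactor_ne_zero (lowerUnipotent (3 * n)) τ
  have hτ0 := τ.ne_zero
  have h3 := h _ τ.im_pos
  have h4 := h _ (lowerUnipotent (3 * n) • τ).im_pos
  rw [h2] at hj
  have h5 : -1 / (3 * ((lowerUnipotent (3 * n) • τ : ℍ) : ℂ)) =
      -1 / (3 * (τ : ℂ)) + (-n : ℤ) := by
    rw [h1]
    field_simp
    push_cast
    ring
  rw [h5, hexTheta_add_int, h3, h1] at h4
  simp only [h1, h2, one_mul, pow_one]
  refine mul_left_cancel₀ (mul_ne_zero hκ hτ0) ?_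
  rw [mul_left_comm, h4]
  rw [← mul_div_assoc, div_mul_eq_mul_div, ← mul_div_assoc, mul_div_cancel_left₀ _ hj]

lemma hexTheta_T_zpow (n : ℤ) : TransformsWith (fun τ => hexTheta τ) 1 1 (ModularGroup.T ^ n) := by
  intro τ
  have h1 : autFactor (ModularGroup.T ^ n) τ = 1 := by
    simp [autFactor, ModularGroup.coe_T_zpow]
  simp only [ModularGroup.coe_T_zpow_smul_eq, hexTheta_add_int, h1]
  ring

lemma exists_two_mul_abs_add_mul_le (a : ℤ) {b : ℤ} (hb : b ≠ 0) : ∃ n : ℤ, 2 * |a + b * n| ≤ |b| := by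
  refine ⟨-round ((a : ℚ) / b), ?_⟩
  have h := abs_sub_round ((a : ℚ) / b)
  have hb' : (b : ℚ) ≠ 0 := by exact_mod_cast hb
  have h2 : ((a + b * -round ((a : ℚ) / b) : ℤ) : ℚ) = b * ((a : ℚ) / b - round ((a : ℚ) / b)) := by
    push_cast
    field_simp
    ring
  have h3 : (2 : ℚ) * |((a + b * -round ((a : ℚ) / b) : ℤ) : ℚ)| ≤ |(b : ℚ)| := by
    rw [h2, abs_mul]
    nlinarith [abs_nonneg (b : ℚ)]
  exact_mod_cast h3

lemma legendreSym_three_congr {d e : ℤ} (h : (3 : ℤ) ∣ d - e) :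
    legendreSym 3 d = legendreSym 3 e := by
  rw [legendreSym, legendreSym]
  congr 1
  rw [← sub_eq_zero, ← Int.cast_sub]
  exact (ZMod.intCast_zmod_eq_zero_iff_dvd _ 3).2 h

/-- Euclidean descent on the lower row `(c, d)`: a translation gives `|d| ≤ |c| / 2`, and then a lower
unipotent matrix of `Γ₀(3)` gives `|c| ≤ 3 |d| / 2`, so `|c|` drops by a factor of at least `3/4`. -/
lemma hexTheta_transforms_of_natAbs_lt (N : ℕ) : ∀ γ : SL(2, ℤ), (γ 1 0).natAbs < N → (3 : ℤ) ∣ γ 1 0 →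
    TransformsWith (fun τ => hexTheta τ) 1 (legendreSym 3 (γ 1 1)) γ := by
  induction N with
  | zero => intro γ h; omega
  | succ N ih =>
    intro γ hN h3
    by_cases h0 : γ 1 0 = 0
    · have hdet := det_eq_one γ
      rw [h0, mul_zero, sub_zero] at hdet
      have key (γ : SL(2, ℤ)) (h0 : γ 1 0 = 0) (h11 : γ 1 1 = 1) (h00 : γ 0 0 = 1) :
          TransformsWith (fun τ => hexTheta τ) 1 1 γ := by
        have : γ = ModularGroup.T ^ (γ 0 1) := by
          ext i j
          fin_cases i <;> fin_cases j <;> simp [ModularGroup.coe_T_zpow, h0, h11, h00]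
        rw [this]
        exact hexTheta_T_zpow _
      rcases Int.mul_eq_one_iff_eq_one_or_neg_one.1 hdet with ⟨h00, h11⟩ | ⟨h00, h11⟩
      · rw [h11, legendreSym.at_one]
        simpa using key γ h0 h11 h00
      · have h := key (-γ) (by simp [h0]) (by simp [h11]) (by simp [h00])
        have hneg : legendreSym 3 (-1) = -1 := by decide
        intro τ
        have h' := h τ
        rw [ModularGroup.SL_neg_smul, autFactor_neg] at h'
        rw [h', h11, hneg]
        push_cast
        ring
    · obtain ⟨n, hn⟩ := exists_two_mul_abs_add_mul_le (γ 1 1) h0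
      obtain ⟨ht0, ht1⟩ := mul_T_zpow_lower_row γ n
      set γ' := γ * ModularGroup.T ^ n with hγ'
      have hd0 : γ' 1 1 ≠ 0 := by
        intro hd
        have := det_eq_one γ'
        rw [hd, ht0] at this
        obtain ⟨e, he⟩ := h3
        rw [he] at this
        have h5 : (3 : ℤ) ∣ 1 := ⟨-(γ' 0 1 * e), by linear_combination -this⟩
        omega
      obtain ⟨m, hm⟩ := exists_two_mul_abs_add_mul_le (γ' 1 0) (mul_ne_zero three_ne_zero hd0)
      obtain ⟨hl0, hl1⟩ := mul_lowerUnipotent_lower_row γ' (3 * m)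
      set γ'' := γ' * lowerUnipotent (3 * m) with hγ''
      have h6 : γ'' 1 0 = γ' 1 0 + 3 * γ' 1 1 * m := by rw [hl0]; ring
      have h7 : 2 * |γ' 1 1| ≤ |γ 1 0| := by rw [ht1, add_comm]; exact hn
      rw [← h6, abs_mul, abs_of_pos (three_pos : (0 : ℤ) < 3)] at hm
      have h8 : |γ 1 0| ≠ 0 := abs_ne_zero.2 h0
      simp only [Int.abs_eq_natAbs] at hm h7 h8
      have h9 := ih γ'' (by omega) (by
        rw [h6, ht0]
        exact h3.add (Dvd.intro (γ' 1 1 * m) (by ring)))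
      have hsym : legendreSym 3 (γ'' 1 1) = legendreSym 3 (γ 1 1) := by
        refine legendreSym_three_congr ?_
        rw [hl1, ht1, add_sub_cancel_right]
        exact h3.mul_right n
      have hback := (h9.mul (hexTheta_lowerUnipotent (-m))).mul (hexTheta_T_zpow (-n))
      rw [hsym, mul_one, mul_one, hγ'', mul_assoc γ', lowerUnipotent_mul, mul_neg, add_neg_cancel,
        lowerUnipotent_zero, mul_one, hγ', mul_assoc, ← zpow_add, add_neg_cancel, zpow_zero,
        mul_one] at hback
      exact hback

lemma hexTheta_transforms {γ : SL(2, ℤ)} (h : (3 : ℤ) ∣ γ 1 0) :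
    TransformsWith (fun τ => hexTheta τ) 1 (legendreSym 3 (γ 1 1)) γ :=
  hexTheta_transforms_of_natAbs_lt _ γ (Nat.lt_succ_self _) h

lemma hexTheta_mul_transforms {a : ℕ} (ha : 0 < a) {γ : SL(2, ℤ)} (h : (3 * a : ℤ) ∣ γ 1 0) :
    TransformsWith (fun τ => hexTheta (a * τ)) 1 (legendreSym 3 (γ 1 1)) γ := by
  intro τ
  obtain ⟨e, he⟩ := h
  have hapos : (0 : ℝ) < a := by exact_mod_cast ha
  let δ : SL(2, ℤ) := ⟨!![γ 0 0, γ 0 1 * a; 3 * e, γ 1 1], by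
    rw [Matrix.det_fin_two_of]
    have := det_eq_one γ
    rw [he] at this
    linear_combination this⟩
  have hδ : (δ : Matrix (Fin 2) (Fin 2) ℤ) = !![γ 0 0, γ 0 1 * a; 3 * e, γ 1 1] := rfl
  have haτ : ((a : ℝ) * (τ : ℂ)).im = a * τ.im := by simp
  let σ : ℍ := ⟨(a : ℝ) * (τ : ℂ), by rw [haτ]; exact mul_pos hapos τ.im_pos⟩
  have hσ : (σ : ℂ) = a * τ := by simp [σ]
  have h1 := hexTheta_transforms (γ := δ) (by simp [hδ]) σ
  have hj : autFactor δ σ = autFactor γ τ := by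
    simp only [autFactor, hσ, hδ, he]
    simp
    ring
  have hs : ((δ • σ : ℍ) : ℂ) = a * ((γ • τ : ℍ) : ℂ) := by
    rw [coe_smul_eq, hj, coe_smul_eq, hσ, hδ]
    simp
    ring
  simp only [hs, hj, hσ] at h1
  simpa [hδ] using h1

/-! ### The mixed theta function and its character -/

lemma summable_tri {τ : ℂ} (hτ : 0 < τ.im) : Summable fun n : ℕ => nome τ ^ (n * (n + 1) / 2) := by
  have h := summable_geometric_of_lt_one (norm_nonneg _) (norm_nome_lt_one hτ)
  refine Summable.of_norm_bounded h fun n => ?_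
  rw [norm_pow]
  refine pow_le_pow_of_le_one (norm_nonneg _) (norm_nome_lt_one hτ).le ?_
  rw [Nat.le_div_iff_mul_le two_pos]
  rcases n with _ | n
  · simp
  · exact Nat.mul_le_mul_left _ (by omega)

lemma thetaTwo_eq_triTheta {τ : ℂ} (hτ : 0 < τ.im) :
    thetaTwo τ = 2 * cexp (Real.pi * I * τ / 4) * triTheta τ := by
  have hs := summable_exp_shifted_square (1 / 2) hτ
  have h1 (n : ℕ) : cexp (Real.pi * I * τ * ((n : ℂ) + 1 / 2) ^ 2) =
      cexp (Real.pi * I * τ / 4) * nome τ ^ (n * (n + 1) / 2) := by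
    rw [nome, ← Complex.exp_nat_mul, ← Complex.exp_add]
    congr 1
    rw [Nat.cast_div (even_iff_two_dvd.1 (Nat.even_mul_succ_self n)) (by norm_num)]
    push_cast
    ring
  have h2 (n : ℕ) : cexp (Real.pi * I * τ * (((-((n : ℤ) + 1) : ℤ) : ℂ) + 1 / 2) ^ 2) =
      cexp (Real.pi * I * τ / 4) * nome τ ^ (n * (n + 1) / 2) := by
    rw [← h1]
    congr 2
    push_cast
    ring
  have h3 := (summable_tri hτ).mul_left (cexp (Real.pi * I * τ / 4))
  rw [thetaTwo, tsum_of_nat_of_neg_add_one]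
  · simp_rw [h2, Int.cast_natCast, h1]
    rw [tsum_mul_left, triTheta]
    ring
  · simp_rw [Int.cast_natCast, h1]
    exact h3
  · simp_rw [h2]
    exact h3

/-- The function `q^{h/8} ψ(τ)` on the upper half plane, where `h` is the sum of the `c_j` (the division
by `8` is exact when `8 ∣ h`). -/
def mixedFun {u k : ℕ} (a : Fin u → ℕ) (c : Fin k → ℕ) (τ : ℍ) : ℂ :=
  nome τ ^ ((∑ j, c j) / 8) * mixedTheta a c τ

lemma im_natCast_mul_pos {n : ℕ} (hn : 0 < n) (τ : ℍ) : 0 < ((n : ℂ) * τ).im := by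
  have h : ((n : ℂ) * τ).im = n * τ.im := by simp
  have : (0 : ℝ) < n := by exact_mod_cast hn
  rw [h]
  exact mul_pos this τ.im_pos

lemma mixedFun_eq {u k : ℕ} (a : Fin u → ℕ) {c : Fin k → ℕ} (hc : ∀ j, 0 < c j)
    (h8 : 8 ∣ ∑ j, c j) (τ : ℍ) :
    mixedFun a c τ = (2 ^ k)⁻¹ * ((∏ i, hexTheta (a i * τ)) * thetaProd c τ) := by
  have h1 : nome τ ^ ((∑ j, c j) / 8) = ∏ j, cexp (Real.pi * I * (c j * τ) / 4) := by
    rw [nome, ← Complex.exp_nat_mul, ← Complex.exp_sum, Nat.cast_div h8 (by norm_num)]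
    congr 1
    push_cast
    rw [Finset.sum_div, Finset.sum_mul]
    exact Finset.sum_congr rfl fun j _ => by ring
  have h2 : thetaProd c τ = 2 ^ k * ((∏ j, cexp (Real.pi * I * (c j * τ) / 4)) *
      ∏ j, triTheta (c j * τ)) := by
    rw [thetaProd, Finset.prod_congr rfl fun j _ => thetaTwo_eq_triTheta (im_natCast_mul_pos (hc j) τ),
      Finset.prod_mul_distrib, Finset.prod_mul_distrib, Finset.prod_const, Finset.card_univ,
      Fintype.card_fin, mul_assoc]
  have h3 : (2 ^ k : ℂ) ≠ 0 := pow_ne_zero _ two_ne_zero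
  rw [mixedFun, mixedTheta, h1, h2, mul_left_comm (∏ i, hexTheta _) (2 ^ k : ℂ),
    inv_mul_cancel_left₀ h3]
  ring

lemma three_mul_dvd_mixedLevel {u k : ℕ} (a : Fin u → ℕ) (c : Fin k → ℕ) (i : Fin u) :
    3 * a i ∣ mixedLevel a c :=
  (Nat.mul_dvd_mul_left 3 (Finset.dvd_lcm (Finset.mem_univ i))).trans (Nat.dvd_lcm_left _ _)

lemma two_mul_dvd_mixedLevel {u k : ℕ} (a : Fin u → ℕ) (c : Fin k → ℕ) (j : Fin k) :
    2 * c j ∣ mixedLevel a c :=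
  (Nat.mul_dvd_mul_left 2 (Finset.dvd_lcm (Finset.mem_univ j))).trans (Nat.dvd_lcm_right _ _)

lemma mixedLevel_ne_zero {u k : ℕ} {a : Fin u → ℕ} (ha : ∀ i, 0 < a i) {c : Fin k → ℕ}
    (hc : ∀ j, 0 < c j) : mixedLevel a c ≠ 0 := by
  refine Nat.lcm_ne_zero (mul_ne_zero three_ne_zero ?_) (mul_ne_zero two_ne_zero ?_)
  · rw [Ne, Finset.lcm_eq_zero_iff]
    rintro ⟨i, _, hi⟩
    exact (ha i).ne' hi
  · rw [Ne, Finset.lcm_eq_zero_iff]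
    rintro ⟨j, _, hj⟩
    exact (hc j).ne' hj

lemma odd_of_isCoprime_mixedLevel {u k : ℕ} {a : Fin u → ℕ} {c : Fin k → ℕ} {d : ℤ}
    (hd : IsCoprime d (mixedLevel a c : ℤ)) : Odd d := by
  have h : IsCoprime d (2 : ℤ) := hd.of_isCoprime_of_dvd_right
    (by exact_mod_cast (Dvd.intro _ rfl).trans (Nat.dvd_lcm_right _ _))
  by_contra hodd
  have := h.isUnit_of_dvd' (Int.not_odd_iff_even.1 hodd).two_dvd (dvd_refl _)
  norm_num [Int.isUnit_iff] at this

lemma legendreSym_three_sq_of_isCoprime {u k : ℕ} {a : Fin u → ℕ} {c : Fin k → ℕ} {d : ℤ}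
    (hd : IsCoprime d (mixedLevel a c : ℤ)) : legendreSym 3 d ^ 2 = 1 := by
  have h : IsCoprime d (3 : ℤ) := hd.of_isCoprime_of_dvd_right
    (by exact_mod_cast (Dvd.intro _ rfl).trans (Nat.dvd_lcm_left _ _))
  refine legendreSym.sq_one 3 ?_
  intro h0
  have h3 := (ZMod.intCast_zmod_eq_zero_iff_dvd d 3).1 h0
  have := h.isUnit_of_dvd' h3 (dvd_refl _)
  norm_num [Int.isUnit_iff] at this

lemma mixedSymbol_eq {u k : ℕ} {a : Fin u → ℕ} {c : Fin k → ℕ} {d : ℤ}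
    (hd : IsCoprime d (mixedLevel a c : ℤ)) :
    mixedSymbol u c d = legendreSym 3 d ^ u * triSymbol c d := by
  have h := legendreSym_three_sq_of_isCoprime hd
  rw [mixedSymbol]
  split_ifs with hu
  · obtain ⟨l, rfl⟩ := hu
    rw [← two_mul, pow_mul, h, one_pow, one_mul]
  · obtain ⟨l, rfl⟩ := Nat.not_even_iff_odd.1 hu
    rw [pow_succ, pow_mul, h, one_pow, one_mul]

lemma mixedFun_transforms {u k : ℕ} (hk : Even k) (hk2 : 2 ≤ k) {a : Fin u → ℕ}
    (ha : ∀ i, 0 < a i) {c : Fin k → ℕ} (hc : ∀ j, 0 < c j) (h8 : 8 ∣ ∑ j, c j) {γ : SL(2, ℤ)}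
    (hγ : (mixedLevel a c : ℤ) ∣ γ 1 0) :
    TransformsWith (mixedFun a c) (u + k / 2) (mixedSymbol u c (γ 1 1)) γ := by
  intro τ
  have hcop : IsCoprime (γ 1 1) (mixedLevel a c : ℤ) :=
    (isCoprime_lower_row γ).symm.of_isCoprime_of_dvd_right hγ
  have h1 (i) : hexTheta (a i * ((γ • τ : ℍ) : ℂ)) = legendreSym 3 (γ 1 1) * autFactor γ τ *
      hexTheta (a i * τ) := by
    have h := hexTheta_mul_transforms (ha i) (γ := γ)
      (dvd_trans (by exact_mod_cast three_mul_dvd_mixedLevel a c i) hγ) τ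
    simpa using h
  have h2 := thetaProd_transforms hk hk2 hc h8 (γ := γ)
    (fun j => dvd_trans (by exact_mod_cast two_mul_dvd_mixedLevel a c j) hγ) τ
  rw [mixedFun_eq a hc h8, mixedFun_eq a hc h8, h2, Finset.prod_congr rfl fun i _ => h1 i,
    Finset.prod_mul_distrib, Finset.prod_const, Finset.card_univ, Fintype.card_fin,
    mixedSymbol_eq hcop]
  push_cast
  ring

lemma mixedFun_I_ne_zero {u k : ℕ} {a : Fin u → ℕ} (ha : ∀ i, 0 < a i) {c : Fin k → ℕ}
    (hc : ∀ j, 0 < c j) : mixedFun a c UpperHalfPlane.I ≠ 0 := by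
  have hnome (n : ℕ) : nome (n * UpperHalfPlane.I) = (Real.exp (-2 * Real.pi * n) : ℂ) := by
    rw [nome, ofReal_exp]
    congr 1
    rw [UpperHalfPlane.coe_I]
    push_cast
    linear_combination 2 * Real.pi * n * I_mul_I
  have hhex (i) : hexTheta (a i * UpperHalfPlane.I) ≠ 0 := by
    have hs := summable_hex (im_natCast_mul_pos (ha i) UpperHalfPlane.I)
    rw [hexTheta]
    simp_rw [hnome, ← ofReal_zpow] at hs ⊢
    rw [← ofReal_tsum]
    refine ofReal_ne_zero.2 (ne_of_gt ?_)
    exact (Complex.summable_ofReal.1 hs).tsum_pos (fun p => (zpow_pos (Real.exp_pos _) _).le) 0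
      (zpow_pos (Real.exp_pos _) _)
  have htri (j) : triTheta (c j * UpperHalfPlane.I) ≠ 0 := by
    have hs := summable_tri (im_natCast_mul_pos (hc j) UpperHalfPlane.I)
    rw [triTheta]
    simp_rw [hnome, ← ofReal_pow] at hs ⊢
    rw [← ofReal_tsum]
    refine ofReal_ne_zero.2 (ne_of_gt ?_)
    exact (Complex.summable_ofReal.1 hs).tsum_pos (fun p => (pow_pos (Real.exp_pos _) _).le) 0
      (pow_pos (Real.exp_pos _) _)
  exact mul_ne_zero (pow_ne_zero _ (nome_ne_zero _)) (mul_ne_zero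
    (Finset.prod_ne_zero_iff.2 fun i _ => hhex i) (Finset.prod_ne_zero_iff.2 fun j _ => htri j))

lemma mixedSymbol_one {u k : ℕ} (c : Fin k → ℕ) : mixedSymbol u c 1 = 1 := by
  have h : triSymbol c 1 = 1 := by
    rw [triSymbol, kroneckerSym_of_odd _ odd_one]
    simp
  rw [mixedSymbol, h, legendreSym.at_one]
  simp

lemma mixedSymbol_mul {u k : ℕ} (c : Fin k → ℕ) {d e : ℤ} (hd : Odd d) (he : Odd e) :
    mixedSymbol u c (d * e) = mixedSymbol u c d * mixedSymbol u c e := by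
  have h : triSymbol c (d * e) = triSymbol c d * triSymbol c e := kroneckerSym_mul _ hd he
  rw [mixedSymbol, mixedSymbol, mixedSymbol]
  split_ifs
  · exact h
  · rw [h, legendreSym.mul]
    ring

/-- Periodicity of the symbol. Both sides are multipliers of `mixedFun`, at `γ T^n` and at `γ` for a
matrix `γ` with lower row `(L, d)`, and `mixedFun` is invariant under `T^n` and does not vanish at
`i`. -/
lemma mixedSymbol_add_mul {u k : ℕ} (hk : Even k) (hk2 : 2 ≤ k) {a : Fin u → ℕ}
    (ha : ∀ i, 0 < a i) {c : Fin k → ℕ} (hc : ∀ j, 0 < c j) (h8 : 8 ∣ ∑ j, c j) {d : ℤ}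
    (hd : IsCoprime d (mixedLevel a c : ℤ)) (n : ℤ) :
    mixedSymbol u c (d + mixedLevel a c * n) = mixedSymbol u c d := by
  obtain ⟨x, y, hxy⟩ := hd
  let γ : SL(2, ℤ) := ⟨!![x, -y; mixedLevel a c, d], by
    rw [Matrix.det_fin_two_of]
    linear_combination hxy⟩
  have hγ0 : γ 1 0 = mixedLevel a c := rfl
  have hγ1 : γ 1 1 = d := rfl
  have hT : TransformsWith (mixedFun a c) (u + k / 2) 1 (ModularGroup.T ^ n) := by
    have h := mixedFun_transforms hk hk2 ha hc h8 (γ := ModularGroup.T ^ n)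
      (by simp [ModularGroup.coe_T_zpow])
    have h1 : (ModularGroup.T ^ n) 1 1 = 1 := by simp [ModularGroup.coe_T_zpow]
    rw [h1, mixedSymbol_one, Int.cast_one] at h
    exact h
  obtain ⟨h0, h1⟩ := mul_T_zpow_lower_row γ n
  have h2 := mixedFun_transforms hk hk2 ha hc h8 (γ := γ * ModularGroup.T ^ n)
    (by rw [h0, hγ0]) UpperHalfPlane.I
  have h3 := (mixedFun_transforms hk hk2 ha hc h8 (γ := γ) (by rw [hγ0])).mul hT UpperHalfPlane.I
  rw [h3, h1, hγ0, hγ1, mul_one] at h2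
  have h4 := mul_right_cancel₀ (pow_ne_zero _ (autFactor_ne_zero _ _))
    (mul_right_cancel₀ (mixedFun_I_ne_zero ha hc) h2)
  rw [add_comm]
  exact_mod_cast h4.symm

lemma exists_mixedCharacter {u k : ℕ} (hk : Even k) (hk2 : 2 ≤ k) {a : Fin u → ℕ}
    (ha : ∀ i, 0 < a i) {c : Fin k → ℕ} (hc : ∀ j, 0 < c j) (h8 : 8 ∣ ∑ j, c j) :
    ∃ χ : DirichletCharacter ℂ (mixedLevel a c), ∀ d : ℤ, IsCoprime d (mixedLevel a c : ℤ) →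
      χ (d : ZMod (mixedLevel a c)) = (mixedSymbol u c d : ℂ) := by
  have : NeZero (mixedLevel a c) := ⟨mixedLevel_ne_zero ha hc⟩
  have hcongr {d e : ℤ} (hd : IsCoprime d (mixedLevel a c : ℤ))
      (h : (d : ZMod (mixedLevel a c)) = e) : mixedSymbol u c d = mixedSymbol u c e := by
    obtain ⟨n, hn⟩ := (ZMod.intCast_eq_intCast_iff_dvd_sub d e _).1 h
    rw [← mixedSymbol_add_mul hk hk2 ha hc h8 hd n, ← hn, add_sub_cancel]
  have hcop (x : (ZMod (mixedLevel a c))ˣ) :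
      IsCoprime (((x : ZMod (mixedLevel a c)).val : ℕ) : ℤ) (mixedLevel a c : ℤ) :=
    Nat.isCoprime_iff_coprime.2 (ZMod.val_coe_unit_coprime x)
  let ψ : (ZMod (mixedLevel a c))ˣ →* ℂ :=
    { toFun := fun x => (mixedSymbol u c ((x : ZMod (mixedLevel a c)).val : ℤ) : ℂ)
      map_one' := by
        rw [hcongr (e := 1) (hcop 1) (by simp), mixedSymbol_one, Int.cast_one]
      map_mul' := fun x y => by
        rw [← Int.cast_mul, ← mixedSymbol_mul c (odd_of_isCoprime_mixedLevel (hcop x))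
          (odd_of_isCoprime_mixedLevel (hcop y))]
        exact congrArg _ (hcongr (hcop _) (by simp)) }
  refine ⟨MulChar.ofUnitHom ψ.toHomUnits, fun d hd => ?_⟩
  have hu : IsUnit (d : ZMod (mixedLevel a c)) :=
    (ZMod.coe_int_isUnit_iff_isCoprime d _).2 hd.symm
  obtain ⟨x, hx⟩ := hu
  rw [← hx, MulChar.ofUnitHom_coe, MonoidHom.coe_toHomUnits]
  exact congrArg (Int.cast : ℤ → ℂ) (hcongr (e := d) (hcop x) (by simp [hx]))

/-! ### Boundedness at the cusps from polynomial growth -/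

section Cusps

open Filter Asymptotics Topology Manifold

/-- Growth at most `C y^K` is `o(exp(2π y / N))`, the inverse of the absolute value of
`exp(2π i z / N)`, so the singularity of the cusp function at `0` is removable. -/
lemma exists_tendsto_of_periodic_of_polynomial_growth {G : ℂ → ℂ} {N : ℕ} (hN : 0 < N)
    (hper : Function.Periodic G (N : ℝ)) (hG : ∀ z : ℂ, 0 < z.im → DifferentiableAt ℂ G z)
    {C : ℝ} {K : ℕ} (hbd : ∀ z : ℂ, 1 ≤ z.im → ‖G z‖ ≤ C * z.im ^ K) :
    ∃ l : ℂ, Tendsto G (comap im atTop) (𝓝 l) := by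
  have hN' : (0 : ℝ) < N := by exact_mod_cast hN
  have hev : ∀ᶠ z : ℂ in comap im atTop, 1 ≤ z.im :=
    tendsto_comap.eventually (eventually_ge_atTop (1 : ℝ))
  have hb : 0 < 2 * Real.pi / N := by positivity
  have ho : G =o[comap im atTop] fun z => Real.exp (2 * Real.pi / N * z.im) := by
    have h1 : G =O[comap im atTop] fun z => z.im ^ K := by
      refine IsBigO.of_bound C ?_
      filter_upwards [hev] with z hz
      rw [Real.norm_of_nonneg (by positivity)]
      exact hbd z hz
    exact h1.trans_isLittleO ((isLittleO_pow_exp_pos_mul_atTop K hb).comp_tendsto tendsto_comap)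
  have hdiff := Function.Periodic.eventually_differentiableAt_cuspFunction_nhds_ne_zero hN' hper
    (hev.mono fun z hz => hG z (by linarith))
  have ho' : (Function.Periodic.cuspFunction N G) =o[𝓝[≠] 0] fun q : ℂ => (q - 0)⁻¹ := by
    have h2 := ho.comp_tendsto (Function.Periodic.invQParam_tendsto hN')
    rw [← isLittleO_norm_right]
    refine h2.congr' ?_ ?_
    · filter_upwards [self_mem_nhdsWithin] with q hq
      exact (Function.Periodic.cuspFunction_eq_of_nonzero _ _ hq).symm
    · filter_upwards [self_mem_nhdsWithin] with q hq
      have hq' : 0 < ‖q‖ := norm_pos_iff.2 hq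
      simp only [Function.comp_apply]
      rw [Function.Periodic.im_invQParam, sub_zero, norm_inv]
      have : 2 * Real.pi / N * (-N / (2 * Real.pi) * Real.log ‖q‖) = -Real.log ‖q‖ := by
        field_simp
      rw [this, Real.exp_neg, Real.exp_log hq']
  have hconst : (fun _ : ℂ => Function.Periodic.cuspFunction N G 0) =o[𝓝[≠] (0 : ℂ)]
      fun q : ℂ => (q - 0)⁻¹ := by
    simp only [sub_zero]
    refine isLittleO_const_left.2 (Or.inr ?_)
    exact tendsto_norm_cobounded_atTop.comp tendsto_inv₀_nhdsNE_zero
  have hlim := tendsto_limUnder_of_differentiable_on_punctured_nhds_of_isLittleO hdiff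
    (ho'.sub hconst)
  refine ⟨_, (hlim.comp (Function.Periodic.qParam_tendsto hN')).congr fun z => ?_⟩
  exact Function.Periodic.eq_cuspFunction hN'.ne' hper z


lemma slash_apply_eq (f : ℍ → ℂ) (w : ℕ) (γ : SL(2, ℤ)) (τ : ℍ) :
    (f ∣[(w : ℤ)] γ) τ = f (γ • τ) * (autFactor γ τ ^ w)⁻¹ := by
  rw [ModularForm.SL_slash_apply, autFactor_eq_denom, zpow_neg, zpow_natCast]

lemma TransformsWith.slash_eq {f : ℍ → ℂ} {w : ℕ} {γ : SL(2, ℤ)} (h : TransformsWith f w 1 γ) :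
    f ∣[(w : ℤ)] γ = f := by
  ext τ
  have hj := pow_ne_zero w (autFactor_ne_zero γ τ)
  rw [slash_apply_eq, h τ, one_mul, mul_right_comm, mul_inv_cancel₀ hj, one_mul]

lemma one_le_norm_autFactor (γ : SL(2, ℤ)) {τ : ℍ} (hτ : 1 ≤ τ.im) : 1 ≤ ‖autFactor γ τ‖ := by
  by_cases h0 : γ 1 0 = 0
  · have hdet := det_eq_one γ
    rw [h0, mul_zero, sub_zero] at hdet
    rw [autFactor, h0]
    rcases Int.mul_eq_one_iff_eq_one_or_neg_one.1 hdet with ⟨_, h⟩ | ⟨_, h⟩ <;> simp [h]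
  · have h1 : (autFactor γ τ).im = γ 1 0 * τ.im := by simp [autFactor]
    have h2 : (1 : ℝ) ≤ |(γ 1 0 : ℝ)| := by
      rw [← Int.cast_abs]
      exact_mod_cast Int.one_le_abs h0
    refine le_trans ?_ (abs_im_le_norm _)
    rw [h1, abs_mul, abs_of_pos τ.im_pos]
    exact one_le_mul_of_one_le_of_one_le h2 hτ

lemma norm_autFactor_le (γ : SL(2, ℤ)) {N : ℕ} {τ : ℍ} (hτ : 1 ≤ τ.im) (hre : |τ.re| ≤ N) :
    ‖autFactor γ τ‖ ≤ (|(γ 1 0 : ℝ)| * (N + 1) + |(γ 1 1 : ℝ)|) * τ.im := by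
  have h1 : ‖(τ : ℂ)‖ ≤ N + τ.im := by
    refine (norm_le_abs_re_add_abs_im _).trans ?_
    rw [UpperHalfPlane.coe_re, UpperHalfPlane.coe_im, abs_of_pos τ.im_pos]
    linarith
  have h2 : ‖autFactor γ τ‖ ≤ |(γ 1 0 : ℝ)| * ‖(τ : ℂ)‖ + |(γ 1 1 : ℝ)| := by
    rw [autFactor]
    refine (norm_add_le _ _).trans ?_
    rw [norm_mul, norm_intCast, norm_intCast]
  have h3 := abs_nonneg (γ 1 0 : ℝ)
  have h4 := abs_nonneg (γ 1 1 : ℝ)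
  have hN : (0 : ℝ) ≤ N := N.cast_nonneg
  have h5 : (N : ℝ) + τ.im ≤ (N + 1) * τ.im := by nlinarith
  nlinarith [mul_le_mul_of_nonneg_left (h1.trans h5) h3, mul_le_mul_of_nonneg_left hτ h4]

lemma im_smul_eq (γ : SL(2, ℤ)) (τ : ℍ) : (γ • τ).im = τ.im / ‖autFactor γ τ‖ ^ 2 := by
  rw [ModularGroup.im_smul_eq_div_normSq, normSq_eq_norm_sq, autFactor_eq_denom]

/-- A form of level `Γ(N)` and non-negative weight that is bounded by a power of `1 + 1/y` is bounded
at every cusp. -/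
lemma isBoundedAtImInfty_slash {f : ℍ → ℂ} (hf : MDiff f) {w N K : ℕ} (hN : 0 < N)
    (hinv : ∀ γ ∈ CongruenceSubgroup.Gamma N, f ∣[(w : ℤ)] γ = f)
    (hbd : ∀ τ : ℍ, ‖f τ‖ ≤ (1 + 1 / τ.im) ^ K) (γ : SL(2, ℤ)) :
    UpperHalfPlane.IsBoundedAtImInfty (f ∣[(w : ℤ)] γ) := by
  have hN' : (0 : ℝ) < N := by exact_mod_cast hN
  set g := f ∣[(w : ℤ)] γ with hg
  have hgdiff : MDiff g := hf.slash _ _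
  have hgT (n : ℤ) : g ∣[(w : ℤ)] (ModularGroup.T ^ (N * n : ℤ)) = g := by
    have hmem : γ * ModularGroup.T ^ (N * n : ℤ) * γ⁻¹ ∈ CongruenceSubgroup.Gamma N :=
      (CongruenceSubgroup.Gamma_normal N).conj_mem _
        (by simpa using CongruenceSubgroup.ModularGroup_T_pow_mem_Gamma N (N * n) ⟨n, rfl⟩) γ
    have h := congrArg (fun F => F ∣[(w : ℤ)] γ) (hinv _ hmem)
    simp only [← SlashAction.slash_mul, inv_mul_cancel_right] at h
    rw [hg, ← SlashAction.slash_mul]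
    exact h
  have hgper (n : ℤ) (τ : ℍ) : g (ModularGroup.T ^ (N * n : ℤ) • τ) = g τ := by
    have h := congrFun (hgT n) τ
    rw [slash_apply_eq] at h
    have h1 : autFactor (ModularGroup.T ^ (N * n : ℤ)) τ = 1 := by
      simp [autFactor, ModularGroup.coe_T_zpow]
    simpa [h1] using h
  set M : ℝ := |(γ 1 0 : ℝ)| * (N + 1) + |(γ 1 1 : ℝ)| with hM
  have hstrip (τ : ℍ) (hτ : 1 ≤ τ.im) (hre : |τ.re| ≤ N) : ‖g τ‖ ≤ (1 + M ^ 2) ^ K * τ.im ^ K := by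
    have h1 := one_le_norm_autFactor γ hτ
    have h2 := norm_autFactor_le γ hτ hre
    rw [← hM] at h2
    rw [hg, slash_apply_eq, norm_mul, norm_inv, norm_pow, ← mul_pow]
    have h3 : (‖autFactor γ τ‖ ^ w)⁻¹ ≤ 1 := inv_le_one_of_one_le₀ (one_le_pow₀ h1)
    refine (mul_le_of_le_one_right (norm_nonneg _) h3).trans ((hbd _).trans ?_)
    refine pow_le_pow_left₀ (by have := (γ • τ).im_pos; positivity) ?_ K
    rw [im_smul_eq, one_div_div, add_mul, one_mul]
    refine add_le_add hτ ?_
    rw [div_le_iff₀ τ.im_pos]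
    calc ‖autFactor γ τ‖ ^ 2 ≤ (M * τ.im) ^ 2 := pow_le_pow_left₀ (norm_nonneg _) h2 2
      _ = _ := by ring
  have hall (τ : ℍ) (hτ : 1 ≤ τ.im) : ‖g τ‖ ≤ (1 + M ^ 2) ^ K * τ.im ^ K := by
    have h1 := hgper (-⌊τ.re / N⌋) τ
    have him : (ModularGroup.T ^ (N * -⌊τ.re / N⌋ : ℤ) • τ).im = τ.im :=
      ModularGroup.im_T_zpow_smul _ _
    have hre : (ModularGroup.T ^ (N * -⌊τ.re / N⌋ : ℤ) • τ).re = τ.re - N * ⌊τ.re / N⌋ := by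
      rw [ModularGroup.re_T_zpow_smul]
      push_cast
      ring
    have h2 := hstrip _ (him ▸ hτ) (by
      have h3 := Int.floor_le (τ.re / N)
      have h4 := Int.lt_floor_add_one (τ.re / N)
      rw [le_div_iff₀ hN'] at h3
      rw [div_lt_iff₀ hN'] at h4
      rw [hre, abs_le]
      constructor <;> nlinarith)
    rwa [h1, him] at h2
  have hper : Function.Periodic (g ∘ UpperHalfPlane.ofComplex) (N : ℝ) := by
    intro z
    by_cases hz : 0 < z.im
    · have hz' : 0 < (z + (N : ℝ)).im := by simpa using hz
      simp only [Function.comp_apply]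
      rw [UpperHalfPlane.ofComplex_apply_of_im_pos hz, UpperHalfPlane.ofComplex_apply_of_im_pos hz',
        ← hgper 1 ⟨z, hz⟩]
      congr 1
      ext
      rw [ModularGroup.coe_T_zpow_smul_eq]
      simp
    · have hz' : (z + (N : ℝ)).im ≤ 0 := by simpa using hz
      simp only [Function.comp_apply]
      rw [UpperHalfPlane.ofComplex_apply_of_im_nonpos (not_lt.1 hz),
        UpperHalfPlane.ofComplex_apply_of_im_nonpos hz']
  obtain ⟨l, hl⟩ := exists_tendsto_of_periodic_of_polynomial_growth hN hper
    (fun z hz => (UpperHalfPlane.mdifferentiable_iff.1 hgdiff).differentiableAt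
      (UpperHalfPlane.isOpen_upperHalfPlaneSet.mem_nhds hz)) (C := (1 + M ^ 2) ^ K) (K := K) (by
      intro z hz
      have hz0 : 0 < z.im := by linarith
      simp only [Function.comp_apply]
      rw [UpperHalfPlane.ofComplex_apply_of_im_pos hz0]
      exact hall ⟨z, hz0⟩ hz)
  have h1 : Tendsto g UpperHalfPlane.atImInfty (𝓝 l) := by
    have h2 : Tendsto (fun τ : ℍ => (τ : ℂ)) UpperHalfPlane.atImInfty (comap im atTop) :=
      UpperHalfPlane.tendsto_coe_atImInfty
    refine (hl.comp h2).congr fun τ => ?_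
    simp
  exact h1.isBigO_one ℝ

end Cusps

/-! ### The mixed theta function as a modular form -/

section Holomorphy

open Manifold

lemma differentiable_nome : Differentiable ℂ nome := by
  unfold nome
  fun_prop

lemma differentiableAt_hexTheta {τ : ℂ} (hτ : 0 < τ.im) : DifferentiableAt ℂ hexTheta τ := by
  have hopen : IsOpen {w : ℂ | τ.im / 2 < w.im} := isOpen_lt continuous_const continuous_im
  have h := Complex.differentiableOn_tsum_of_summable_norm
    (F := fun (p : ℤ × ℤ) (w : ℂ) => nome w ^ (p.1 ^ 2 + p.1 * p.2 + p.2 ^ 2))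
    (summable_hexBound (half_pos hτ))
    (fun p => fun w _ => ((differentiable_nome w).zpow (Or.inl (nome_ne_zero w))).differentiableWithinAt)
    hopen (fun p w hw => norm_hex_term_le (half_pos hτ) (le_of_lt hw) p)
  exact h.differentiableAt (hopen.mem_nhds (half_lt_self hτ))

lemma norm_tri_term_le {r : ℝ} (hr : r ≤ 1) {τ : ℂ} (h : ‖nome τ‖ ≤ r) (n : ℕ) :
    ‖nome τ ^ (n * (n + 1) / 2)‖ ≤ r ^ n := by
  rw [norm_pow]
  refine (pow_le_pow_of_le_one (norm_nonneg _) (h.trans hr) ?_).trans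
    (pow_le_pow_left₀ (norm_nonneg _) h n)
  rw [Nat.le_div_iff_mul_le two_pos]
  rcases n with _ | n
  · simp
  · exact Nat.mul_le_mul_left _ (by omega)

lemma differentiableAt_triTheta {τ : ℂ} (hτ : 0 < τ.im) : DifferentiableAt ℂ triTheta τ := by
  have hopen : IsOpen {w : ℂ | τ.im / 2 < w.im} := isOpen_lt continuous_const continuous_im
  have hr : Real.exp (-2 * Real.pi * (τ.im / 2)) < 1 := by
    rw [Real.exp_lt_one_iff]
    nlinarith [Real.pi_pos]
  have h := Complex.differentiableOn_tsum_of_summable_norm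
    (F := fun (n : ℕ) (w : ℂ) => nome w ^ (n * (n + 1) / 2))
    (summable_geometric_of_lt_one (Real.exp_pos _).le hr)
    (fun p => fun w _ => ((differentiable_nome w).pow _).differentiableWithinAt)
    hopen (fun p w hw => norm_tri_term_le hr.le (by
      rw [norm_nome, Real.exp_le_exp]
      have : τ.im / 2 < w.im := hw
      nlinarith [Real.pi_pos]) p)
  exact h.differentiableAt (hopen.mem_nhds (half_lt_self hτ))

lemma mdifferentiable_mixedFun {u k : ℕ} {a : Fin u → ℕ} (ha : ∀ i, 0 < a i) {c : Fin k → ℕ}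
    (hc : ∀ j, 0 < c j) : MDiff (mixedFun a c) := by
  have him {n : ℕ} (hn : 0 < n) {z : ℂ} (hz : 0 < z.im) : 0 < ((n : ℂ) * z).im :=
    im_natCast_mul_pos hn ⟨z, hz⟩
  rw [UpperHalfPlane.mdifferentiable_iff]
  have h : DifferentiableOn ℂ (fun z => nome z ^ ((∑ j, c j) / 8) * mixedTheta a c z)
      {z | 0 < z.im} := by
    intro z hz
    refine DifferentiableAt.differentiableWithinAt ?_
    refine ((differentiable_nome z).pow _).mul (DifferentiableAt.mul ?_ ?_)
    · refine DifferentiableAt.fun_finsetProd fun i _ => ?_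
      exact DifferentiableAt.comp z (differentiableAt_hexTheta (him (ha i) hz))
        (differentiableAt_id.const_mul _)
    · refine DifferentiableAt.fun_finsetProd fun j _ => ?_
      exact DifferentiableAt.comp z (differentiableAt_triTheta (him (hc j) hz))
        (differentiableAt_id.const_mul _)
  refine h.congr fun z hz => ?_
  rw [Function.comp_apply, UpperHalfPlane.ofComplex_apply_of_im_pos hz, mixedFun]

lemma one_div_one_sub_exp_le {x : ℝ} (hx : 0 < x) : (1 - Real.exp (-x))⁻¹ ≤ 1 + 1 / x := by
  have h1 : 1 + x ≤ Real.exp x := by linarith [Real.add_one_le_exp x]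
  have h2 : Real.exp (-x) ≤ (1 + x)⁻¹ := by
    rw [Real.exp_neg]
    exact inv_anti₀ (by linarith) h1
  have h3 : x / (1 + x) ≤ 1 - Real.exp (-x) := by
    have : x / (1 + x) = 1 - (1 + x)⁻¹ := by field_simp; ring
    linarith
  refine (inv_anti₀ (by positivity) h3).trans (le_of_eq ?_)
  field_simp
  ring

lemma norm_triTheta_le {τ : ℂ} (hτ : 0 < τ.im) : ‖triTheta τ‖ ≤ 1 + 1 / τ.im := by
  have hlt := norm_nome_lt_one hτ
  have h : ‖triTheta τ‖ ≤ (1 - ‖nome τ‖)⁻¹ :=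
    tsum_of_norm_bounded (hasSum_geometric_of_lt_one (norm_nonneg _) hlt)
      fun n => norm_tri_term_le hlt.le le_rfl n
  rw [norm_nome] at h
  have h1 : -2 * Real.pi * τ.im = -(2 * Real.pi * τ.im) := by ring
  rw [h1] at h
  refine h.trans ((one_div_one_sub_exp_le (by positivity)).trans ?_)
  have h2 : τ.im ≤ 2 * Real.pi * τ.im := by nlinarith [Real.pi_gt_three]
  gcongr

lemma tsum_gaussian_le {y : ℝ} (hy : 0 < y) :
    ∑' n : ℤ, Real.exp (-Real.pi * y * n ^ 2) ≤ 1 + 1 / y := by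
  have h1 : ((∑' n : ℤ, Real.exp (-Real.pi * y * n ^ 2) : ℝ) : ℂ) = jacobiTheta (I * y) := by
    rw [ofReal_tsum, jacobiTheta]
    refine tsum_congr fun n => ?_
    rw [ofReal_exp]
    congr 1
    push_cast
    linear_combination (-Real.pi * y * n ^ 2) * I_mul_I
  have h2 := norm_jacobiTheta_sub_one_le (τ := I * y) (by simpa using hy)
  have him : (I * (y : ℂ)).im = y := by simp
  rw [him] at h2
  have hx : 0 < Real.pi * y := by positivity
  have h3 := one_div_one_sub_exp_le hx
  have hlt : Real.exp (-(Real.pi * y)) < 1 := by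
    rw [Real.exp_lt_one_iff]
    linarith
  have h4 : 2 / (1 - Real.exp (-Real.pi * y)) * Real.exp (-Real.pi * y) =
      2 * ((1 - Real.exp (-(Real.pi * y)))⁻¹ - 1) := by
    have : 1 - Real.exp (-(Real.pi * y)) ≠ 0 := by linarith
    rw [neg_mul]
    field_simp
    ring
  rw [h4, ← h1] at h2
  have h5 : (∑' n : ℤ, Real.exp (-Real.pi * y * n ^ 2)) - 1 ≤ 2 * (1 / (Real.pi * y)) := by
    have h6 := (le_abs_self _).trans_eq (norm_real
      ((∑' n : ℤ, Real.exp (-Real.pi * y * n ^ 2)) - 1)).symm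
    push_cast at h6 h2
    linarith
  have h7 : 2 * (1 / (Real.pi * y)) ≤ 1 / y := by
    rw [mul_one_div, div_le_div_iff₀ hx hy]
    nlinarith [Real.pi_gt_three]
  linarith

lemma norm_hexTheta_le {τ : ℂ} (hτ : 0 < τ.im) : ‖hexTheta τ‖ ≤ (1 + 1 / τ.im) ^ 2 := by
  have h1 : ‖hexTheta τ‖ ≤ ∑' p, hexBound τ.im p :=
    tsum_of_norm_bounded (summable_hexBound hτ).hasSum fun p => norm_hex_term_le hτ le_rfl p
  have h2 : ∑' p, hexBound τ.im p = (∑' n : ℤ, Real.exp (-Real.pi * τ.im * n ^ 2)) ^ 2 := by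
    rw [sq, tsum_mul_tsum_of_summable_norm (summable_gaussian hτ).norm (summable_gaussian hτ).norm]
    rfl
  rw [h2] at h1
  exact h1.trans (pow_le_pow_left₀ (tsum_nonneg fun _ => (Real.exp_pos _).le)
    (tsum_gaussian_le hτ) 2)

lemma norm_mixedFun_le {u k : ℕ} {a : Fin u → ℕ} (ha : ∀ i, 0 < a i) {c : Fin k → ℕ}
    (hc : ∀ j, 0 < c j) (τ : ℍ) : ‖mixedFun a c τ‖ ≤ (1 + 1 / τ.im) ^ (2 * u + k) := by
  have hmono {n : ℕ} (hn : 0 < n) : 1 + 1 / ((n : ℂ) * τ).im ≤ 1 + 1 / τ.im := by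
    have h1 : ((n : ℂ) * τ).im = n * τ.im := by simp
    have h2 : (1 : ℝ) ≤ n := by exact_mod_cast hn
    have h3 := τ.im_pos
    rw [h1]
    gcongr
    nlinarith
  have hhex (i) : ‖hexTheta (a i * τ)‖ ≤ (1 + 1 / τ.im) ^ 2 := by
    have hp := im_natCast_mul_pos (ha i) τ
    exact (norm_hexTheta_le hp).trans (pow_le_pow_left₀ (by positivity) (hmono (ha i)) 2)
  have htri (j) : ‖triTheta (c j * τ)‖ ≤ 1 + 1 / τ.im :=
    (norm_triTheta_le (im_natCast_mul_pos (hc j) τ)).trans (hmono (hc j))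
  have hnome : ‖nome τ ^ ((∑ j, c j) / 8)‖ ≤ 1 := by
    rw [norm_pow]
    exact pow_le_one₀ (norm_nonneg _) (norm_nome_lt_one τ.im_pos).le
  have h1 : ∏ i, ‖hexTheta (a i * τ)‖ ≤ ((1 + 1 / τ.im) ^ 2) ^ u := by
    refine (Finset.prod_le_prod (fun _ _ => norm_nonneg _) fun i _ => hhex i).trans_eq ?_
    rw [Finset.prod_const, Finset.card_univ, Fintype.card_fin]
  have h2 : ∏ j, ‖triTheta (c j * τ)‖ ≤ (1 + 1 / τ.im) ^ k := by
    refine (Finset.prod_le_prod (fun _ _ => norm_nonneg _) fun j _ => htri j).trans_eq ?_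
    rw [Finset.prod_const, Finset.card_univ, Fintype.card_fin]
  rw [mixedFun, mixedTheta, norm_mul, norm_mul, norm_prod, norm_prod, pow_add, pow_mul]
  have h3 : (0 : ℝ) ≤ ∏ i, ‖hexTheta (a i * τ)‖ := Finset.prod_nonneg fun _ _ => norm_nonneg _
  have h4 : (0 : ℝ) ≤ ∏ j, ‖triTheta (c j * τ)‖ := Finset.prod_nonneg fun _ _ => norm_nonneg _
  refine (mul_le_of_le_one_left (mul_nonneg h3 h4) hnome).trans ?_
  exact mul_le_mul h1 h2 h4 (h3.trans h1)

lemma mixedFun_slash_of_mem_Gamma1 {u k : ℕ} (hk : Even k) (hk2 : 2 ≤ k) {a : Fin u → ℕ}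
    (ha : ∀ i, 0 < a i) {c : Fin k → ℕ} (hc : ∀ j, 0 < c j) (h8 : 8 ∣ ∑ j, c j) {γ : SL(2, ℤ)}
    (hγ : γ ∈ CongruenceSubgroup.Gamma1 (mixedLevel a c)) :
    mixedFun a c ∣[((u + k / 2 : ℕ) : ℤ)] γ = mixedFun a c := by
  obtain ⟨_, h11, h10⟩ := (CongruenceSubgroup.Gamma1_mem _ _).1 hγ
  have h1 := mixedFun_transforms hk hk2 ha hc h8 (γ := γ)
    ((ZMod.intCast_zmod_eq_zero_iff_dvd _ _).1 h10)
  obtain ⟨n, hn⟩ := (ZMod.intCast_eq_intCast_iff_dvd_sub 1 (γ 1 1) (mixedLevel a c)).1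
    (by rw [h11, Int.cast_one])
  have hd : γ 1 1 = 1 + mixedLevel a c * n := by linarith
  have h2 : mixedSymbol u c (γ 1 1) = 1 := by
    rw [hd, mixedSymbol_add_mul (u := u) hk hk2 ha hc h8 isCoprime_one_left n, mixedSymbol_one]
  rw [h2, Int.cast_one] at h1
  exact h1.slash_eq

lemma exists_mixedModularForm {u k : ℕ} (hk : Even k) (hk2 : 2 ≤ k) {a : Fin u → ℕ}
    (ha : ∀ i, 0 < a i) {c : Fin k → ℕ} (hc : ∀ j, 0 < c j) (h8 : 8 ∣ ∑ j, c j) :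
    ∃ f : ModularForm ((CongruenceSubgroup.Gamma1 (mixedLevel a c)).map
      (Matrix.SpecialLinearGroup.mapGL ℝ)) ((u + k / 2 : ℕ) : ℤ), ∀ τ, f τ = mixedFun a c τ := by
  have hL := mixedLevel_ne_zero ha hc
  have : NeZero (mixedLevel a c) := ⟨hL⟩
  refine ⟨{ toFun := mixedFun a c
            slash_action_eq' := ?_
            holo' := mdifferentiable_mixedFun ha hc
            bdd_at_cusps' := ?_ }, fun τ => rfl⟩
  · rintro _ ⟨γ, hγ, rfl⟩
    exact mixedFun_slash_of_mem_Gamma1 hk hk2 ha hc h8 hγ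
  · intro x hx
    rw [Subgroup.IsArithmetic.isCusp_iff_isCusp_SL2Z] at hx
    rw [OnePoint.isBoundedAt_iff_forall_SL2Z hx]
    intro γ _
    refine isBoundedAtImInfty_slash (mdifferentiable_mixedFun ha hc) (Nat.pos_of_ne_zero hL)
      (fun δ hδ => mixedFun_slash_of_mem_Gamma1 hk hk2 ha hc h8 ?_) (norm_mixedFun_le ha hc) γ
    rw [CongruenceSubgroup.Gamma_mem] at hδ
    exact (CongruenceSubgroup.Gamma1_mem _ _).2 ⟨hδ.1, hδ.2.2.2, hδ.2.2.1⟩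

end Holomorphy

/-! ### Representation numbers as Fourier coefficients -/

/-- A finite product of absolutely convergent series, expanded as a series over tuples of indices. -/
lemma summable_norm_and_hasSum_prod_pi {ι : Type*} {n : ℕ} (F : Fin n → ι → ℂ)
    (hF : ∀ i, Summable fun x => ‖F i x‖) :
    (Summable fun x : Fin n → ι => ‖∏ i, F i (x i)‖) ∧
      HasSum (fun x : Fin n → ι => ∏ i, F i (x i)) (∏ i, ∑' x, F i x) := by
  induction n with
  | zero =>
    exact ⟨Summable.of_finite, by simp⟩
  | succ n ih =>
    obtain ⟨h1, h2⟩ := ih (fun i => F i.succ) fun i => hF _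
    have h3 := summable_mul_of_summable_norm (hF 0) h1
    have h4 := (hF 0).mul_norm h1
    have h5 := (hF 0).of_norm.hasSum.mul h2 h3
    constructor
    · rw [← (Fin.consEquiv fun _ => ι).summable_iff]
      refine h4.congr fun p => ?_
      simp [Fin.prod_univ_succ, Fin.consEquiv]
    · rw [← (Fin.consEquiv fun _ => ι).hasSum_iff, Fin.prod_univ_succ]
      have e : (fun x : Fin (n + 1) → ι => ∏ i, F i (x i)) ∘ Fin.consEquiv (fun _ => ι) =
          fun p => F 0 p.1 * ∏ i, F i.succ (p.2 i) := by
        funext p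
        simp [Fin.prod_univ_succ, Fin.consEquiv]
      rw [e]
      exact h5

lemma mixedForm_nonneg {u k : ℕ} (a : Fin u → ℕ) (c : Fin k → ℕ)
    (x : Fin u → ℤ × ℤ) (z : Fin k → ℕ) : 0 ≤ mixedForm a c x z := by
  refine add_nonneg (Finset.sum_nonneg fun i _ => mul_nonneg (Int.natCast_nonneg _) ?_)
    (Finset.sum_nonneg fun j _ => by positivity)
  nlinarith [sq_nonneg ((x i).1 + (x i).2), sq_nonneg (x i).1, sq_nonneg (x i).2]

lemma nome_pow_mixedForm {u k : ℕ} (a : Fin u → ℕ) (c : Fin k → ℕ) (τ : ℂ)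
    (x : Fin u → ℤ × ℤ) (z : Fin k → ℕ) :
    nome τ ^ (mixedForm a c x z).toNat =
      (∏ i, nome (a i * τ) ^ ((x i).1 ^ 2 + (x i).1 * (x i).2 + (x i).2 ^ 2)) *
        ∏ j, nome (c j * τ) ^ (z j * (z j + 1) / 2) := by
  rw [← zpow_natCast, Int.toNat_of_nonneg (mixedForm_nonneg a c x z)]
  simp_rw [← zpow_natCast (nome _), nome_zpow]
  rw [← Complex.exp_sum, ← Complex.exp_sum, ← Complex.exp_add, mixedForm, Int.cast_add,
    Int.cast_sum, Int.cast_sum, mul_add, Finset.mul_sum, Finset.mul_sum]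
  congr 2 <;> refine Finset.sum_congr rfl fun i _ => ?_
  · rw [Int.cast_mul, Int.cast_natCast (a i)]
    ring
  · rw [Int.cast_mul, Int.cast_natCast (c i)]
    ring

lemma hasSum_mixedTheta {u k : ℕ} {a : Fin u → ℕ} (ha : ∀ i, 0 < a i) {c : Fin k → ℕ}
    (hc : ∀ j, 0 < c j) (τ : ℍ) :
    HasSum (fun p : (Fin u → ℤ × ℤ) × (Fin k → ℕ) =>
      nome τ ^ (mixedForm a c p.1 p.2).toNat) (mixedTheta a c τ) := by
  obtain ⟨h1, h2⟩ := summable_norm_and_hasSum_prod_pi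
    (fun (i : Fin u) (p : ℤ × ℤ) => nome (a i * τ) ^ (p.1 ^ 2 + p.1 * p.2 + p.2 ^ 2))
    fun i => (summable_hex (im_natCast_mul_pos (ha i) τ)).norm
  obtain ⟨h3, h4⟩ := summable_norm_and_hasSum_prod_pi
    (fun (j : Fin k) (n : ℕ) => nome (c j * τ) ^ (n * (n + 1) / 2))
    fun j => (summable_tri (im_natCast_mul_pos (hc j) τ)).norm
  have h5 := summable_mul_of_summable_norm h1 h3
  have h6 := h2.mul h4 h5
  have e : (fun p : (Fin u → ℤ × ℤ) × (Fin k → ℕ) => nome τ ^ (mixedForm a c p.1 p.2).toNat) =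
      fun p => (∏ i, nome (a i * τ) ^ ((p.1 i).1 ^ 2 + (p.1 i).1 * (p.1 i).2 + (p.1 i).2 ^ 2)) *
        ∏ j, nome (c j * τ) ^ (p.2 j * (p.2 j + 1) / 2) :=
    funext fun p => nome_pow_mixedForm a c τ p.1 p.2
  rw [e]
  exact h6

/-- Grouping the terms of the expanded product by the value of the form. The fibres are finite because
the series is absolutely convergent and its terms are nonzero and constant on them, so the value given
by `tsum_const` is an honest count. -/
lemma hasSum_mixedRepr {u k : ℕ} {a : Fin u → ℕ} (ha : ∀ i, 0 < a i) {c : Fin k → ℕ}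
    (hc : ∀ j, 0 < c j) (τ : ℍ) :
    HasSum (fun n : ℕ => (mixedRepr a c n : ℂ) * nome (τ : ℂ) ^ n) (mixedTheta a c (τ : ℂ)) := by
  have h := hasSum_mixedTheta ha hc τ
  set v : (Fin u → ℤ × ℤ) × (Fin k → ℕ) → ℕ := fun p => (mixedForm a c p.1 p.2).toNat with hv
  rw [← (Equiv.sigmaFiberEquiv v).hasSum_iff] at h
  refine h.sigma fun n => ?_
  have hterm (p : {p // v p = n}) : ((fun p => nome τ ^ v p) ∘ Equiv.sigmaFiberEquiv v) ⟨n, p⟩ =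
      nome τ ^ n := by
    have := p.2
    simp [Equiv.sigmaFiberEquiv, this]
  have hs : Summable fun _ : {p // v p = n} => nome (τ : ℂ) ^ n :=
    (h.summable.sigma_factor n).congr hterm
  have hsum := hs.hasSum
  rw [tsum_const, nsmul_eq_mul] at hsum
  have hcard : mixedRepr a c n = Nat.card {p // v p = n} := by
    rw [mixedRepr, ← Nat.card_coe_set_eq]
    refine Nat.card_congr (Equiv.subtypeEquivRight fun p => ?_)
    have := mixedForm_nonneg a c p.1 p.2
    simp only [Set.mem_ofPred_eq, hv]
    omega
  rw [hcard]
  convert hsum using 1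
  exact funext hterm

end MixedForms

end

open MixedForms
theorem theorem1p3 (u k : ℕ) (hk : Even k) (hk2 : 2 ≤ k)
    (a : Fin u → ℕ) (ha : ∀ i, 0 < a i) (c : Fin k → ℕ) (hc : ∀ j, 0 < c j)
    (h8 : 8 ∣ ∑ j, c j) :
    (∀ τ : UpperHalfPlane,
      HasSum (fun n : ℕ => (mixedRepr a c n : ℂ) * nome (τ : ℂ) ^ n) (mixedTheta a c (τ : ℂ))) ∧
    ∃ χ' : DirichletCharacter ℂ (mixedLevel a c),
      (∀ d : ℤ, IsCoprime d (mixedLevel a c : ℤ) →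
        χ' (d : ZMod (mixedLevel a c)) = (mixedSymbol u c d : ℂ)) ∧
      ∃ f ∈ formsWithCharacter ((u + k / 2 : ℕ) : ℤ) (mixedLevel a c) χ',
        ∀ τ : UpperHalfPlane,
          f τ = nome (τ : ℂ) ^ ((∑ j, c j) / 8) * mixedTheta a c (τ : ℂ) := by
  obtain ⟨χ, hχ⟩ := exists_mixedCharacter hk hk2 ha hc h8
  obtain ⟨f, hf⟩ := exists_mixedModularForm hk hk2 ha hc h8
  refine ⟨hasSum_mixedRepr ha hc, χ, hχ, f, fun γ hγ τ => ?_, hf⟩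
  have hdvd := (ZMod.intCast_zmod_eq_zero_iff_dvd _ _).1 (CongruenceSubgroup.Gamma0_mem.1 hγ)
  rw [hχ _ ((isCoprime_lower_row γ).symm.of_isCoprime_of_dvd_right hdvd), hf, hf,
    mixedFun_transforms hk hk2 ha hc h8 hdvd τ, zpow_natCast]
  rfl
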